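/- Let $\mathbf{R}^3_1$ be $\mathbf{R}^3$ with coordinates $(x,y,t)$ and the Lorentzian product $v\cdot w=v_1w_1+v_2w_2-v_3w_3$. For a smooth map $f$ from an open subset of the plane to $\mathbf{R}^3_1$ with partial derivatives $f_u,f_v$, let $\tilde\nu=\mathrm{diag}(1,1,-1)(f_u\times_E f_v)$, where $\times_E$ is the Euclidean vector product, let $$P=\begin{pmatrix} f_u\cdot f_u& f_u\cdot f_v\\ f_v\cdot f_u& f_v\cdot f_v\end{pmatrix},\qquad Q=\begin{pmatrix} f_{uu}\cdot\tilde\nu& f_{uv}\cdot\tilde\nu\\ f_{vu}\cdot\tilde\nu& f_{vv}\cdot\tilde\nu\end{pmatrix},$$ and put $B_f=\det P$, $A_f=\operatorname{trace}(\tilde P Q)$, where $\tilde P$ is the cofactor matrix of $P$. A point is space-like, time-like or null for $f$ according as $B_f>0$, $B_f<0$ or $B_f=0$ there. A ZMC-map is a smooth map that is an immersion on an open dense set and has $A_f\equiv0$; a ZMC-embedding is a ZMC-map that is an embedding (an immersion that is a homeomorphism onto its image). A map $f:U\to\mathbf{R}^3_1$ contains an entire null line $L$ if $L$ is a complete light-like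 line and there is a smooth curve $\gamma:I\to U$ on an open interval $I$ such that $\gamma(I)$ consists of null points of $f$ and $f(\gamma(I))=L$. **Theorem.** Let $c_1>0$, $c_2<0$ and $c_3>0$. There exist a domain (a connected open set) $U\subset\mathbf{R}^2$ containing the whole $y$-axis and real analytic functions $\psi_1,\psi_2,\psi_3:U\to\mathbf{R}$ such that, for each $i\in\{1,2,3\}$, the graph map $f_i(x,y)=(x,y,\psi_i(x,y))$ is a ZMC-embedding of $U$ into $\mathbf{R}^3_1$ that contains the entire null line $\{(0,y,y)\,;\,y\in\mathbf{R}\}$, and this line is of type $\alpha^0_I$, i.e. $\psi_i$ has on $U$ a convergent expansion $$\psi_i(x,y)=y+\frac{\alpha_i(y)}{2}x^2+\sum_{k=3}^\infty\frac{\beta_{i,k}(y)}{k}x^k,\qquad \alpha_i\equiv 0,$$ whose coefficients $\beta_{i,k}$ are real analytic functions on $\mathbf{R}$. Moreover: (i) $\beta_{1,3}(y)=3c_1y$ and $\beta_{1,k}(0)=\beta_{1,k}'(0)=0$ for all $k\ge4$, and $f_1$ is of mixed type, i.e. $B_{f_1}$ takes both positive and negative values on $U$; (ii) $\beta_{2,3}\equiv0$,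 $\beta_{2,4}(y)=4c_2y$ and $\beta_{2,k}(0)=\beta_{2,k}'(0)=0$ for all $k\ge5$, and the space-like points of $f_2$ are exactly the points of $U$ off the $y$-axis; (iii) $\beta_{3,3}\equiv0$, $\beta_{3,4}(y)=4c_3y$ and $\beta_{3,k}(0)=\beta_{3,k}'(0)=0$ for all $k\ge5$, and the time-like points of $f_3$ are exactly the points of $U$ off the $y$-axis. -/

import Mathlib

open scoped ContDiff

noncomputable section

namespace ZMC

/-- The canonical Lorentzian product of signature `(++-)` on `ℝ³`, coordinates `(x, y, t)`. -/
def lorentz (v w : Fin 3 → ℝ) : ℝ := v 0 * w 0 + v 1 * w 1 - v 2 * w 2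

/-- The partial derivative with respect to the first variable of the plane. -/
def partialU {E : Type*} [NormedAddCommGroup E] [NormedSpace ℝ E] (f : ℝ × ℝ → E) :
    ℝ × ℝ → E := fun p => fderiv ℝ f p (1, 0)

/-- The partial derivative with respect to the second variable of the plane. -/
def partialV {E : Type*} [NormedAddCommGroup E] [NormedSpace ℝ E] (f : ℝ × ℝ → E) :
    ℝ × ℝ → E := fun p => fderiv ℝ f p (0, 1)

/-- The first fundamental matrix `P` of `f`. -/
def matP (f : ℝ × ℝ → Fin 3 → ℝ) (p : ℝ × ℝ) : Matrix (Fin 2) (Fin 2) ℝ :=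
  !![lorentz (partialU f p) (partialU f p), lorentz (partialU f p) (partialV f p);
     lorentz (partialV f p) (partialU f p), lorentz (partialV f p) (partialV f p)]

/-- `B_f = det P`. -/
def B (f : ℝ × ℝ → Fin 3 → ℝ) (p : ℝ × ℝ) : ℝ := (matP f p).det

/-- The Lorentzian normal field: the matrix `diag(1, 1, -1)` applied to the Euclidean
vector product of the partial derivatives of `f`. -/
def normal (f : ℝ × ℝ → Fin 3 → ℝ) (p : ℝ × ℝ) : Fin 3 → ℝ :=
  Matrix.mulVec (Matrix.diagonal ![1, 1, -1]) (crossProduct (partialU f p) (partialV f p))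

/-- The second fundamental matrix `Q` of `f` with respect to `normal f`; here `f_{uv}` is
`partialV (partialU f)`. -/
def matQ (f : ℝ × ℝ → Fin 3 → ℝ) (p : ℝ × ℝ) : Matrix (Fin 2) (Fin 2) ℝ :=
  !![lorentz (partialU (partialU f) p) (normal f p),
       lorentz (partialV (partialU f) p) (normal f p);
     lorentz (partialU (partialV f) p) (normal f p),
       lorentz (partialV (partialV f) p) (normal f p)]

/-- `A_f = trace (P̃ Q)`, where `P̃` is the cofactor matrix of the symmetric matrix `P`. -/
def A (f : ℝ × ℝ → Fin 3 → ℝ) (p : ℝ × ℝ) : ℝ :=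
  ((matP f p).adjugate * matQ f p).trace

/-- `p` is a space-like point of `f`. -/
def IsSpaceLikePoint (f : ℝ × ℝ → Fin 3 → ℝ) (p : ℝ × ℝ) : Prop := 0 < B f p

/-- `p` is a time-like point of `f`. -/
def IsTimeLikePoint (f : ℝ × ℝ → Fin 3 → ℝ) (p : ℝ × ℝ) : Prop := B f p < 0

/-- `p` is a null (light-like) point of `f`: neither space-like nor time-like. -/
def IsNullPoint (f : ℝ × ℝ → Fin 3 → ℝ) (p : ℝ × ℝ) : Prop :=
  ¬ IsSpaceLikePoint f p ∧ ¬ IsTimeLikePoint f p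

/-- `f` is a ZMC-map on the open set `U`: it is smooth on `U`, an immersion on an open dense
subset of `U`, and `A_f` vanishes identically on `U`. -/
def IsZMCMap (U : Set (ℝ × ℝ)) (f : ℝ × ℝ → Fin 3 → ℝ) : Prop :=
  ContDiffOn ℝ ∞ f U ∧
  (∃ V : Set (ℝ × ℝ), IsOpen V ∧ V ⊆ U ∧ U ⊆ closure V ∧
    ∀ p ∈ V, Function.Injective (fderiv ℝ f p)) ∧
  ∀ p ∈ U, A f p = 0

/-- A ZMC-embedding of the open set `U`: a ZMC-map that is an immersion at every point of `U`
and a homeomorphism of `U` onto its image. -/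
def IsZMCEmbedding (U : Set (ℝ × ℝ)) (f : ℝ × ℝ → Fin 3 → ℝ) : Prop :=
  IsZMCMap U f ∧ (∀ p ∈ U, Function.Injective (fderiv ℝ f p)) ∧
  Topology.IsEmbedding (fun p : U => f p)

/-- `L` is a complete light-like line in `ℝ³₁`. -/
def IsLightLikeLine (L : Set (Fin 3 → ℝ)) : Prop :=
  ∃ a v : Fin 3 → ℝ, v ≠ 0 ∧ lorentz v v = 0 ∧ L = Set.range fun t : ℝ => a + t • v

/-- `f`, defined on `U`, contains the entire null line `L`: there is a smooth curve `γ` from an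
open interval `I` to `U` such that `γ(I)` consists of null points of `f` and `f ∘ γ (I)` is the
complete light-like line `L`. -/
def ContainsEntireNullLine (U : Set (ℝ × ℝ)) (f : ℝ × ℝ → Fin 3 → ℝ)
    (L : Set (Fin 3 → ℝ)) : Prop :=
  IsLightLikeLine L ∧
  ∃ (I : Set ℝ) (γ : ℝ → ℝ × ℝ), IsOpen I ∧ I.OrdConnected ∧ I.Nonempty ∧
    ContDiffOn ℝ ∞ γ I ∧ Set.MapsTo γ I U ∧ (∀ s ∈ I, IsNullPoint f (γ s)) ∧
    (fun s => f (γ s)) '' I = L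

/-- The null line `{(0, y, y)}`. -/
def nullLine : Set (Fin 3 → ℝ) := Set.range fun y : ℝ => ![0, y, y]

/-- The graph map `(x, y) ↦ (x, y, ψ(x, y))`. -/
def graphMap (ψ : ℝ × ℝ → ℝ) (p : ℝ × ℝ) : Fin 3 → ℝ := ![p.1, p.2, ψ p]

/-- On `U`, `ψ(x, y) = y + (α(y) / 2) x² + ∑_{k ≥ 3} (β_k(y) / k) x^k`, where `α` and the `β_k`,
`k ≥ 3`, are real analytic on `ℝ`. The summation index below is `j = k - 3`. -/
def HasExpansion (U : Set (ℝ × ℝ)) (ψ : ℝ × ℝ → ℝ) (α : ℝ → ℝ) (β : ℕ → ℝ → ℝ) : Prop :=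
  AnalyticOnNhd ℝ α Set.univ ∧ (∀ k, 3 ≤ k → AnalyticOnNhd ℝ (β k) Set.univ) ∧
  ∀ x y : ℝ, (x, y) ∈ U →
    HasSum (fun j : ℕ => β (j + 3) y / ((j : ℝ) + 3) * x ^ (j + 3))
      (ψ (x, y) - (y + α y / 2 * x ^ 2))

/-- The function `α⁰_I`, identically zero. -/
def alphaZeroI : ℝ → ℝ := fun _ => 0

/-- The real analytic function `ψ` on `U` has as its graph a ZMC-embedding containing the entire
null line `{(0, y, y)}`, which is of type `α⁰_I`, and `β` is the sequence of coefficients of the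
expansion of `ψ` along the line. -/
def IsZMCGraphOfTypeZeroI (U : Set (ℝ × ℝ)) (ψ : ℝ × ℝ → ℝ) (β : ℕ → ℝ → ℝ) : Prop :=
  AnalyticOnNhd ℝ ψ U ∧ IsZMCEmbedding U (graphMap ψ) ∧
  ContainsEntireNullLine U (graphMap ψ) nullLine ∧ HasExpansion U ψ alphaZeroI β

/-- `f` is of mixed type on `U`: `B_f` changes its sign on `U`. -/
def IsMixedType (U : Set (ℝ × ℝ)) (f : ℝ × ℝ → Fin 3 → ℝ) : Prop :=
  (∃ p ∈ U, IsSpaceLikePoint f p) ∧ ∃ q ∈ U, IsTimeLikePoint f q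

end ZMC

end

open scoped ENNReal NNReal
open Finset

/-! The solutions come from the ansatz `ψ = y + s y h(p, e)` with `s = c x^(l+3)`, `p = c x^(l+1)
y²`, `e = c² x^(2l+4) y²`, so that `e = s p`. Multiplied by `y` and divided by `s`, the zero mean
curvature equation closes up in `p` and `e` alone: `y∂_y (y∂_y + 1) h = 2p · (quadratic in h) + e ·
(cubic in h)`, where the right side involves the operators `x∂ₓ` and `y∂_y` up to second order. All
these operators are diagonal on monomials `p^a e^b`, and the left one has eigenvalue `2n(2n+1)` in
total degree `n = a + b`.

The equation is therefore of Fuchsian type. The constant term of `h` is free and is set to `1`; the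
factors `p` and `e` make every later coefficient depend only on those of lower degree. Dividing by
`2n(2n+1)` regains the two derivatives lost on the right (`wnormTwo_step_le`), so for a small radius
the iteration stays in a ball of a weighted `ℓ¹` space (`exists_radius`), and its coefficientwise
limit converges (`exists_solution`, `A_height`).

On the whole `y`-axis `p = e = 0`, so convergence near `(p, e) = 0` gives a neighbourhood of the
entire axis, thinner as `|y|` grows. There `B = -s · θ` with `θ` near `2` (`B_height`,
`exists_signFactor_pos`). Hence `l = 0` gives a sign change across the axis, and `l = 1` gives the
constant sign of `-c` off it. -/

instance : HasAntidiagonal (ℕ × ℕ) where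
  antidiagonal d := (antidiagonal d.1 ×ˢ antidiagonal d.2).map
    (Equiv.prodProdProdComm ℕ ℕ ℕ ℕ).toEmbedding
  mem_antidiagonal := by
    rintro ⟨m, n⟩ ⟨⟨a, b⟩, ⟨a', b'⟩⟩
    simp [Equiv.prodProdProdComm]

/-- Formal double power series, given by their coefficients. -/
abbrev DoubleSeries := ℕ × ℕ → ℝ

/-! ### Double power series: weighted `ℓ¹` algebra, evaluation, analyticity -/

namespace DoubleSeries

/-- The total degree of a bi-index. -/
def deg (d : ℕ × ℕ) : ℕ := d.1 + d.2

lemma deg_add (d e : ℕ × ℕ) : deg (d + e) = deg d + deg e := by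
  simp only [deg, Prod.fst_add, Prod.snd_add]; ring

/-- The Cauchy product. -/
def conv (f g : DoubleSeries) : DoubleSeries :=
  fun d => ∑ ij ∈ antidiagonal d, f ij.1 * g ij.2

/-- The weighted `ℓ¹` norm with radius `ρ`. -/
noncomputable def wnorm (ρ : ℝ≥0) (f : DoubleSeries) : ℝ≥0∞ :=
  ∑' d, ‖f d‖ₑ * (ρ : ℝ≥0∞) ^ deg d

/-- The sum of the series. -/
noncomputable def eval (f : DoubleSeries) (z : ℝ × ℝ) : ℝ :=
  ∑' d : ℕ × ℕ, f d * (z.1 ^ d.1 * z.2 ^ d.2)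

lemma wnorm_add_le (ρ : ℝ≥0) (f g : DoubleSeries) :
    wnorm ρ (f + g) ≤ wnorm ρ f + wnorm ρ g := by
  unfold wnorm
  rw [← ENNReal.tsum_add]
  refine ENNReal.tsum_le_tsum fun d => ?_
  rw [← add_mul]
  gcongr
  exact enorm_add_le _ _

lemma wnorm_sub_le (ρ : ℝ≥0) (f g : DoubleSeries) :
    wnorm ρ (f - g) ≤ wnorm ρ f + wnorm ρ g := by
  unfold wnorm
  rw [← ENNReal.tsum_add]
  refine ENNReal.tsum_le_tsum fun d => ?_
  rw [← add_mul]
  gcongr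
  exact enorm_sub_le

lemma wnorm_single (ρ : ℝ≥0) (i : ℕ × ℕ) (r : ℝ) :
    wnorm ρ (Pi.single i r) = ‖r‖ₑ * (ρ : ℝ≥0∞) ^ deg i := by
  unfold wnorm
  rw [tsum_eq_single i]
  · simp
  · intro d hd
    simp [Pi.single_eq_of_ne hd]

/-- Degrees add along an antidiagonal, so the weights factor; the antidiagonals partition all pairs
of indices. Sums in `ℝ≥0∞` need no summability hypothesis. -/
lemma wnorm_conv_le (ρ : ℝ≥0) (f g : DoubleSeries) :
    wnorm ρ (conv f g) ≤ wnorm ρ f * wnorm ρ g := by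
  calc wnorm ρ (conv f g)
      ≤ ∑' d, ∑ ij ∈ antidiagonal d,
          (‖f ij.1‖ₑ * (ρ : ℝ≥0∞) ^ deg ij.1) * (‖g ij.2‖ₑ * (ρ : ℝ≥0∞) ^ deg ij.2) := by
        refine ENNReal.tsum_le_tsum fun d => ?_
        calc ‖conv f g d‖ₑ * (ρ : ℝ≥0∞) ^ deg d
            ≤ (∑ ij ∈ antidiagonal d, ‖f ij.1 * g ij.2‖ₑ) * (ρ : ℝ≥0∞) ^ deg d := by
              gcongr
              exact enorm_sum_le _ _
          _ = _ := by
              rw [sum_mul]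
              refine sum_congr rfl fun ij hij => ?_
              rw [← mem_antidiagonal.1 hij, deg_add, pow_add, enorm_mul]
              ring
    _ = ∑' x : Σ d : ℕ × ℕ, antidiagonal d,
          (‖f x.2.1.1‖ₑ * (ρ : ℝ≥0∞) ^ deg x.2.1.1) *
            (‖g x.2.1.2‖ₑ * (ρ : ℝ≥0∞) ^ deg x.2.1.2) := by
        rw [ENNReal.tsum_sigma']
        refine tsum_congr fun d => ?_
        rw [tsum_fintype, ← sum_coe_sort]
    _ = ∑' x : (ℕ × ℕ) × (ℕ × ℕ),
          (‖f x.1‖ₑ * (ρ : ℝ≥0∞) ^ deg x.1) * (‖g x.2‖ₑ * (ρ : ℝ≥0∞) ^ deg x.2) :=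
        (Finset.HasAntidiagonal.sigmaAntidiagonalEquivProd (A := ℕ × ℕ)).tsum_eq
          (fun x => (‖f x.1‖ₑ * (ρ : ℝ≥0∞) ^ deg x.1) * (‖g x.2‖ₑ * (ρ : ℝ≥0∞) ^ deg x.2))
    _ = wnorm ρ f * wnorm ρ g := by
        rw [ENNReal.tsum_prod']
        simp_rw [ENNReal.tsum_mul_left, ENNReal.tsum_mul_right]
        rfl

lemma summable_of_wnorm {ρ : ℝ≥0} {f : DoubleSeries} (hf : wnorm ρ f ≠ ⊤) :
    Summable fun d => ‖f d‖ * (ρ : ℝ) ^ deg d := by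
  have : wnorm ρ f = ∑' d, ((‖f d‖₊ * ρ ^ deg d : ℝ≥0) : ℝ≥0∞) := by
    unfold wnorm
    simp [enorm_eq_nnnorm]
  rw [this] at hf
  have h := ENNReal.tsum_coe_ne_top_iff_summable_coe.1 hf
  simpa using h

lemma norm_monomial_le {ρ : ℝ≥0} {z : ℝ × ℝ} (hz : ‖z‖ ≤ ρ) (d : ℕ × ℕ) :
    ‖z.1 ^ d.1 * z.2 ^ d.2‖ ≤ (ρ : ℝ) ^ deg d := by
  rw [norm_mul, norm_pow, norm_pow, deg, pow_add]
  gcongr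
  · exact (norm_fst_le z).trans hz
  · exact (norm_snd_le z).trans hz

lemma summable_norm_eval {ρ : ℝ≥0} {f : DoubleSeries} (hf : wnorm ρ f ≠ ⊤) {z : ℝ × ℝ}
    (hz : ‖z‖ ≤ ρ) : Summable fun d : ℕ × ℕ => ‖f d * (z.1 ^ d.1 * z.2 ^ d.2)‖ := by
  refine (summable_of_wnorm hf).of_nonneg_of_le (fun d => norm_nonneg _) fun d => ?_
  rw [norm_mul]
  gcongr
  exact norm_monomial_le hz d

lemma hasSum_eval {ρ : ℝ≥0} {f : DoubleSeries} (hf : wnorm ρ f ≠ ⊤) {z : ℝ × ℝ}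
    (hz : ‖z‖ ≤ ρ) : HasSum (fun d : ℕ × ℕ => f d * (z.1 ^ d.1 * z.2 ^ d.2)) (eval f z) :=
  (summable_norm_eval hf hz).of_norm.hasSum

lemma eval_add {ρ : ℝ≥0} {f g : DoubleSeries} (hf : wnorm ρ f ≠ ⊤) (hg : wnorm ρ g ≠ ⊤)
    {z : ℝ × ℝ} (hz : ‖z‖ ≤ ρ) : eval (f + g) z = eval f z + eval g z := by
  rw [eval, ← ((hasSum_eval hf hz).add (hasSum_eval hg hz)).tsum_eq]
  simp [add_mul]

lemma eval_sub {ρ : ℝ≥0} {f g : DoubleSeries} (hf : wnorm ρ f ≠ ⊤) (hg : wnorm ρ g ≠ ⊤)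
    {z : ℝ × ℝ} (hz : ‖z‖ ≤ ρ) : eval (f - g) z = eval f z - eval g z := by
  rw [eval, ← ((hasSum_eval hf hz).sub (hasSum_eval hg hz)).tsum_eq]
  simp [sub_mul]

lemma eval_single (i : ℕ × ℕ) (r : ℝ) (z : ℝ × ℝ) :
    eval (Pi.single i r) z = r * (z.1 ^ i.1 * z.2 ^ i.2) := by
  unfold eval
  rw [tsum_eq_single i]
  · simp
  · intro d hd
    simp [Pi.single_eq_of_ne hd]

lemma eval_zero (f : DoubleSeries) : eval f 0 = f 0 := by
  unfold eval
  rw [tsum_eq_single 0]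
  · simp
  · rintro ⟨a, b⟩ hd
    rcases a with _ | a
    · rcases b with _ | b
      · exact absurd rfl hd
      · simp
    · simp

lemma eval_conv {ρ : ℝ≥0} {f g : DoubleSeries} (hf : wnorm ρ f ≠ ⊤) (hg : wnorm ρ g ≠ ⊤)
    {z : ℝ × ℝ} (hz : ‖z‖ ≤ ρ) : eval (conv f g) z = eval f z * eval g z := by
  have h := (summable_norm_eval hf hz).of_norm.tsum_mul_tsum_eq_tsum_sum_antidiagonal
    (summable_norm_eval hg hz).of_norm
    (summable_mul_of_summable_norm (summable_norm_eval hf hz) (summable_norm_eval hg hz))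
  simp only [eval]
  rw [h]
  refine tsum_congr fun d => ?_
  rw [conv, sum_mul]
  refine sum_congr rfl fun ij hij => ?_
  rw [← mem_antidiagonal.1 hij, Prod.fst_add, Prod.snd_add, pow_add, pow_add]
  ring

/-- The monomial `z₁ ^ a z₂ ^ (N - a)` as a multilinear form. -/
noncomputable def monomialForm (N a : ℕ) :
    ContinuousMultilinearMap ℝ (fun _ : Fin N => ℝ × ℝ) ℝ :=
  (ContinuousMultilinearMap.mkPiAlgebraFin ℝ N ℝ).compContinuousLinearMap
    fun i => if (i : ℕ) < a then ContinuousLinearMap.fst ℝ ℝ ℝ else ContinuousLinearMap.snd ℝ ℝ ℝ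

lemma norm_monomialForm_le (N a : ℕ) : ‖monomialForm N a‖ ≤ 1 := by
  refine (ContinuousMultilinearMap.norm_compContinuousLinearMap_le _ _).trans ?_
  rw [ContinuousMultilinearMap.norm_mkPiAlgebraFin, one_mul]
  refine prod_le_one (fun i _ => norm_nonneg _) fun i _ => ?_
  split_ifs
  · exact ContinuousLinearMap.norm_fst_le ℝ ℝ ℝ
  · exact ContinuousLinearMap.norm_snd_le ℝ ℝ ℝ

lemma monomialForm_apply (a b : ℕ) (z : ℝ × ℝ) :
    (monomialForm (a + b) a fun _ => z) = z.1 ^ a * z.2 ^ b := by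
  simp only [monomialForm, ContinuousMultilinearMap.compContinuousLinearMap_apply,
    ContinuousMultilinearMap.mkPiAlgebraFin_apply, List.prod_ofFn]
  rw [Fin.prod_univ_add]
  simp

/-- The formal multilinear series attached to a double series. -/
noncomputable def toFMS (f : DoubleSeries) : FormalMultilinearSeries ℝ (ℝ × ℝ) ℝ :=
  fun N => ∑ d ∈ antidiagonal N, f d • monomialForm N d.1

lemma hasSum_antidiagonal {F : ℕ × ℕ → ℝ} {s : ℝ} (h : HasSum F s) :
    HasSum (fun N : ℕ => ∑ d ∈ antidiagonal N, F d) s := by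
  have h' := (Finset.HasAntidiagonal.sigmaAntidiagonalEquivProd (A := ℕ)).hasSum_iff.2 h
  refine h'.sigma fun N => ?_
  have := hasSum_fintype (fun c : antidiagonal N => F c)
  rw [sum_coe_sort (antidiagonal N) F] at this
  exact this

/-- Grouping the absolutely convergent double series by total degree turns each finite antidiagonal
into one homogeneous term. -/
lemma hasFPowerSeriesOnBall_eval {ρ : ℝ≥0} (hρ : 0 < ρ) {f : DoubleSeries}
    (hf : wnorm ρ f ≠ ⊤) : HasFPowerSeriesOnBall (eval f) (toFMS f) 0 ρ where
  r_pos := by simpa using hρ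
  r_le := by
    have hs := hasSum_antidiagonal (summable_of_wnorm hf).hasSum
    refine FormalMultilinearSeries.le_radius_of_bound _ (∑' d, ‖f d‖ * (ρ : ℝ) ^ deg d)
      fun N => ?_
    calc ‖toFMS f N‖ * (ρ : ℝ) ^ N
        ≤ (∑ d ∈ antidiagonal N, ‖f d‖) * (ρ : ℝ) ^ N := by
          gcongr
          refine (norm_sum_le _ _).trans (sum_le_sum fun d _ => ?_)
          rw [norm_smul]
          exact mul_le_of_le_one_right (norm_nonneg _) (norm_monomialForm_le _ _)
      _ = ∑ d ∈ antidiagonal N, ‖f d‖ * (ρ : ℝ) ^ deg d := by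
          rw [sum_mul]
          refine sum_congr rfl fun d hd => ?_
          rw [deg, mem_antidiagonal.1 hd]
      _ ≤ _ := le_hasSum hs N fun M _ => sum_nonneg fun d _ => by positivity
  hasSum := by
    intro z hz
    have hz' : ‖z‖ ≤ ρ := by
      have : ‖z‖ < ρ := by simpa [edist_eq_enorm_sub, enorm_eq_nnnorm] using hz
      exact this.le
    rw [zero_add]
    refine (hasSum_antidiagonal (hasSum_eval hf hz')).congr_fun ?_
    intro N
    simp only [toFMS, _root_.sum_apply, _root_.smul_apply,
      smul_eq_mul]
    refine sum_congr rfl fun d hd => ?_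
    obtain rfl := mem_antidiagonal.1 hd
    rw [monomialForm_apply]

lemma analyticOnNhd_eval {ρ : ℝ≥0} (hρ : 0 < ρ) {f : DoubleSeries} (hf : wnorm ρ f ≠ ⊤) :
    AnalyticOnNhd ℝ (eval f) (Metric.ball 0 ρ) := by
  have := (hasFPowerSeriesOnBall_eval hρ hf).analyticOnNhd
  rwa [Metric.eball_coe] at this

/-- Multiplication of the coefficients by the first index. -/
def euler₁ (f : DoubleSeries) : DoubleSeries := fun d => d.1 * f d

/-- Multiplication of the coefficients by the second index. -/
def euler₂ (f : DoubleSeries) : DoubleSeries := fun d => d.2 * f d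

lemma norm_deriv_pow_le {ρ : ℝ≥0} (hρ : 0 < ρ) {t : ℝ} (ht : ‖t‖ ≤ ρ) (n : ℕ) :
    ‖(n : ℝ) * t ^ (n - 1)‖ ≤ n * (ρ : ℝ) ^ n * (ρ : ℝ)⁻¹ := by
  have hρ' : (0 : ℝ) < ρ := hρ
  rcases n with _ | n
  · simp
  · rw [norm_mul, norm_pow, pow_succ, mul_assoc, mul_assoc, mul_inv_cancel₀ hρ'.ne', mul_one]
    simp only [add_tsub_cancel_right, RCLike.norm_natCast]
    gcongr

/-- The factor `z.1` avoids an index shift: Euler operators act diagonally on coefficients and keep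
the radius. -/
lemma fderiv_eval_fst {ρ : ℝ≥0} (hρ : 0 < ρ) {f : DoubleSeries} (hf : wnorm ρ f ≠ ⊤)
    (hf₁ : wnorm ρ (euler₁ f) ≠ ⊤) {z : ℝ × ℝ} (hz : z ∈ Metric.ball 0 (ρ : ℝ)) :
    z.1 * fderiv ℝ (eval f) z (1, 0) = eval (euler₁ f) z := by
  obtain ⟨p, q⟩ := z
  have hz' : ‖((p, q) : ℝ × ℝ)‖ < ρ := by simpa using hz
  have hp : ‖p‖ < ρ := (norm_fst_le (p, q)).trans_lt hz'
  have hq : ‖q‖ < ρ := (norm_snd_le (p, q)).trans_lt hz'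
  have hd : HasDerivAt (fun t => eval f (t, q))
      (∑' d : ℕ × ℕ, f d * (d.1 * p ^ (d.1 - 1) * q ^ d.2)) p := by
    refine hasDerivAt_tsum_of_isPreconnected
      (g := fun (d : ℕ × ℕ) t => f d * (t ^ d.1 * q ^ d.2))
      (g' := fun (d : ℕ × ℕ) t => f d * (d.1 * t ^ (d.1 - 1) * q ^ d.2))
      (u := fun d => ‖euler₁ f d‖ * (ρ : ℝ) ^ deg d * (ρ : ℝ)⁻¹)
      (t := Metric.ball 0 ρ) (y₀ := p) ((summable_of_wnorm hf₁).mul_right _)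
      Metric.isOpen_ball (convex_ball _ _).isPreconnected ?_ ?_ (by simpa using hp)
      (hasSum_eval hf hz'.le).summable (by simpa using hp)
    · intro d t _
      have h := ((hasDerivAt_pow d.1 t).mul_const (q ^ d.2)).const_mul (f d)
      exact h
    · intro d t ht
      have ht' : ‖t‖ ≤ ρ := by simpa using (Metric.mem_ball.1 ht).le
      have h1 := norm_deriv_pow_le hρ ht' d.1
      calc ‖f d * (d.1 * t ^ (d.1 - 1) * q ^ d.2)‖
          = ‖f d‖ * (‖d.1 * t ^ (d.1 - 1)‖ * ‖q‖ ^ d.2) := by rw [norm_mul, norm_mul, norm_pow]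
        _ ≤ ‖f d‖ * ((d.1 * (ρ : ℝ) ^ d.1 * (ρ : ℝ)⁻¹) * (ρ : ℝ) ^ d.2) := by gcongr
        _ = _ := by
          rw [euler₁, norm_mul, deg, pow_add, RCLike.norm_natCast]
          ring
  have hF : HasDerivAt (fun t => eval f (t, q)) (fderiv ℝ (eval f) (p, q) (1, 0)) p := by
    have h1 := (analyticOnNhd_eval hρ hf _ hz).differentiableAt.hasFDerivAt
    exact h1.comp_hasDerivAt p ((hasDerivAt_id p).prodMk (hasDerivAt_const p q))
  rw [hF.unique hd, ← tsum_mul_left]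
  refine tsum_congr fun d => ?_
  rcases d with ⟨_ | a, b⟩
  · simp [euler₁]
  · simp only [euler₁, add_tsub_cancel_right, pow_succ]
    ring

lemma fderiv_eval_snd {ρ : ℝ≥0} (hρ : 0 < ρ) {f : DoubleSeries} (hf : wnorm ρ f ≠ ⊤)
    (hf₂ : wnorm ρ (euler₂ f) ≠ ⊤) {z : ℝ × ℝ} (hz : z ∈ Metric.ball 0 (ρ : ℝ)) :
    z.2 * fderiv ℝ (eval f) z (0, 1) = eval (euler₂ f) z := by
  obtain ⟨p, q⟩ := z
  have hz' : ‖((p, q) : ℝ × ℝ)‖ < ρ := by simpa using hz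
  have hp : ‖p‖ < ρ := (norm_fst_le (p, q)).trans_lt hz'
  have hq : ‖q‖ < ρ := (norm_snd_le (p, q)).trans_lt hz'
  have hd : HasDerivAt (fun t => eval f (p, t))
      (∑' d : ℕ × ℕ, f d * (p ^ d.1 * (d.2 * q ^ (d.2 - 1)))) q := by
    refine hasDerivAt_tsum_of_isPreconnected
      (g := fun (d : ℕ × ℕ) t => f d * (p ^ d.1 * t ^ d.2))
      (g' := fun (d : ℕ × ℕ) t => f d * (p ^ d.1 * (d.2 * t ^ (d.2 - 1))))
      (u := fun d => ‖euler₂ f d‖ * (ρ : ℝ) ^ deg d * (ρ : ℝ)⁻¹)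
      (t := Metric.ball 0 ρ) (y₀ := q) ((summable_of_wnorm hf₂).mul_right _)
      Metric.isOpen_ball (convex_ball _ _).isPreconnected ?_ ?_ (by simpa using hq)
      (hasSum_eval hf hz'.le).summable (by simpa using hq)
    · intro d t _
      have h := ((hasDerivAt_pow d.2 t).const_mul (p ^ d.1)).const_mul (f d)
      exact h
    · intro d t ht
      have ht' : ‖t‖ ≤ ρ := by simpa using (Metric.mem_ball.1 ht).le
      have h1 := norm_deriv_pow_le hρ ht' d.2
      calc ‖f d * (p ^ d.1 * (d.2 * t ^ (d.2 - 1)))‖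
          = ‖f d‖ * (‖p‖ ^ d.1 * ‖d.2 * t ^ (d.2 - 1)‖) := by rw [norm_mul, norm_mul, norm_pow]
        _ ≤ ‖f d‖ * ((ρ : ℝ) ^ d.1 * (d.2 * (ρ : ℝ) ^ d.2 * (ρ : ℝ)⁻¹)) := by gcongr
        _ = _ := by
          rw [euler₂, norm_mul, deg, pow_add, RCLike.norm_natCast]
          ring
  have hF : HasDerivAt (fun t => eval f (p, t)) (fderiv ℝ (eval f) (p, q) (0, 1)) q := by
    have h1 := (analyticOnNhd_eval hρ hf _ hz).differentiableAt.hasFDerivAt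
    exact h1.comp_hasDerivAt q ((hasDerivAt_const q p).prodMk (hasDerivAt_id q))
  rw [hF.unique hd, ← tsum_mul_left]
  refine tsum_congr fun d => ?_
  rcases d with ⟨a, _ | b⟩
  · simp [euler₂]
  · simp only [euler₂, add_tsub_cancel_right, pow_succ]
    ring

end DoubleSeries

/-! ### The Fuchsian equation: formal solution and convergence -/

namespace DoubleSeries

/-- Two double series agree in degrees less than `n`. -/
def Agree (n : ℕ) (f g : DoubleSeries) : Prop := ∀ d, deg d < n → f d = g d

lemma Agree.mul {n : ℕ} {f g : DoubleSeries} (h : Agree n f g) (μ : ℕ × ℕ → ℝ) :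
    Agree n (fun d => μ d * f d) (fun d => μ d * g d) := fun d hd => by
  simp only [h d hd]

lemma Agree.add {n : ℕ} {f g f' g' : DoubleSeries} (h : Agree n f g) (h' : Agree n f' g') :
    Agree n (f + f') (g + g') := fun d hd => by
  simp only [Pi.add_apply, h d hd, h' d hd]

lemma Agree.sub {n : ℕ} {f g f' g' : DoubleSeries} (h : Agree n f g) (h' : Agree n f' g') :
    Agree n (f - f') (g - g') := fun d hd => by
  simp only [Pi.sub_apply, h d hd, h' d hd]

lemma Agree.conv {n : ℕ} {f g f' g' : DoubleSeries} (h : Agree n f g) (h' : Agree n f' g') :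
    Agree n (conv f f') (conv g g') := fun d hd => by
  refine sum_congr rfl fun ij hij => ?_
  rw [← mem_antidiagonal.1 hij, deg_add] at hd
  rw [h _ (by omega), h' _ (by omega)]

/-- A factor without constant term raises the degree, which gains one order of agreement. This is
what makes the recursion for the coefficients well founded. -/
lemma Agree.conv_left {n : ℕ} {s f g : DoubleSeries} (hs : s 0 = 0) (h : Agree n f g) :
    Agree (n + 1) (DoubleSeries.conv s f) (DoubleSeries.conv s g) := fun d hd => by
  refine sum_congr rfl fun ij hij => ?_
  rw [← mem_antidiagonal.1 hij, deg_add] at hd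
  rcases Nat.eq_zero_or_pos (deg ij.1) with h0 | h0
  · have : ij.1 = 0 := by
      unfold deg at h0
      ext <;> simp <;> omega
    simp [this, hs]
  · rw [h _ (by omega)]

/-- The eigenvalue of `x ∂ₓ` on the monomial with index `d`. -/
def xExp (l : ℕ) (d : ℕ × ℕ) : ℕ := (l + 1) * d.1 + (2 * l + 4) * d.2

/-- The coefficients of `(y ∂_y + 1) h`. -/
def serY (h : DoubleSeries) : DoubleSeries := fun d => (2 * deg d + 1) * h d

/-- The coefficients of `(x ∂ₓ + l + 3) h`. -/
def serX (l : ℕ) (h : DoubleSeries) : DoubleSeries := fun d => (xExp l d + (l + 3)) * h d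

/-- The coefficients of `(x ∂ₓ + l + 2) (x ∂ₓ + l + 3) h`. -/
def serXX (l : ℕ) (h : DoubleSeries) : DoubleSeries :=
  fun d => ((xExp l d + (l + 2)) * (xExp l d + (l + 3))) * h d

/-- The coefficients of `(y ∂_y + 1) (x ∂ₓ + l + 3) h`. -/
def serXY (l : ℕ) (h : DoubleSeries) : DoubleSeries :=
  fun d => ((2 * deg d + 1) * (xExp l d + (l + 3))) * h d

/-- The coefficients of `y ∂_y (y ∂_y + 1) h`. -/
def serYY (h : DoubleSeries) : DoubleSeries := fun d => (2 * deg d * (2 * deg d + 1)) * h d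

/-- The quadratic part of the zero mean curvature equation. -/
def quadPart (l : ℕ) (h : DoubleSeries) : DoubleSeries :=
  conv (serY h) (serXX l h) - conv (serX l h) (serXY l h)

/-- The cubic part of the zero mean curvature equation. -/
def cubicPart (l : ℕ) (h : DoubleSeries) : DoubleSeries :=
  conv (serY h) (quadPart l h) -
    conv (serX l h) (conv (serY h) (serXY l h) - conv (serX l h) (serYY h))

/-- The right-hand side of the zero mean curvature equation in its Fuchsian form. -/
def rhs (l : ℕ) (h : DoubleSeries) : DoubleSeries :=
  conv (Pi.single (1, 0) 2) (quadPart l h) + conv (Pi.single (0, 1) 1) (cubicPart l h)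

/-- The map whose fixed points are the solutions with leading coefficient one. -/
noncomputable def step (l : ℕ) (h : DoubleSeries) : DoubleSeries :=
  fun d => if d = 0 then 1 else rhs l h d / (2 * deg d * (2 * deg d + 1))

lemma Agree.rhs {n l : ℕ} {f g : DoubleSeries} (h : Agree n f g) :
    Agree (n + 1) (rhs l f) (rhs l g) := by
  have hq : Agree n (quadPart l f) (quadPart l g) :=
    ((h.mul _).conv (h.mul _)).sub ((h.mul _).conv (h.mul _))
  have hc : Agree n (cubicPart l f) (cubicPart l g) :=
    ((h.mul _).conv hq).sub
      ((h.mul _).conv (((h.mul _).conv (h.mul _)).sub ((h.mul _).conv (h.mul _))))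
  exact (Agree.conv_left (by simp) hq).add (Agree.conv_left (by simp) hc)

lemma Agree.step {n l : ℕ} {f g : DoubleSeries} (h : Agree n f g) :
    Agree (n + 1) (step l f) (step l g) := fun d hd => by
  simp only [DoubleSeries.step, h.rhs d hd]

lemma rhs_zero (l : ℕ) (h : DoubleSeries) : rhs l h 0 = 0 := by
  have : ∀ s f : DoubleSeries, s 0 = 0 → conv s f 0 = 0 := fun s f hs => by
    have hf : Agree 0 f 0 := fun d hd => absurd hd (Nat.not_lt_zero _)
    rw [Agree.conv_left hs hf 0 (by simp [deg])]
    simp [conv]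
  simp [rhs, this]

/-- The `ℓ¹` norm controlling two derivatives. -/
noncomputable def wnormTwo (ρ : ℝ≥0) (h : DoubleSeries) : ℝ≥0∞ :=
  wnorm ρ fun d => ((deg d : ℝ) + 1) ^ 2 * h d

/-- A multiplier of quadratic growth is an operator of order at most two. -/
lemma wnorm_mul_le {ρ M : ℝ≥0} {h : DoubleSeries} {μ : ℕ × ℕ → ℝ}
    (hμ : ∀ d, |μ d| ≤ M * ((deg d : ℝ) + 1) ^ 2) :
    wnorm ρ (fun d => μ d * h d) ≤ M * wnormTwo ρ h := by
  unfold wnormTwo wnorm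
  rw [← ENNReal.tsum_mul_left]
  refine ENNReal.tsum_le_tsum fun d => ?_
  rw [← mul_assoc]
  gcongr
  have : ‖μ d * h d‖₊ ≤ M * ‖((deg d : ℝ) + 1) ^ 2 * h d‖₊ := by
    rw [← NNReal.coe_le_coe]
    simp only [nnnorm_mul, NNReal.coe_mul, coe_nnnorm]
    rw [← mul_assoc]
    gcongr
    rw [Real.norm_eq_abs, Real.norm_eq_abs, abs_of_nonneg (sq_nonneg ((deg d : ℝ) + 1))]
    exact hμ d
  simpa [enorm_eq_nnnorm] using ENNReal.coe_le_coe.2 this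

lemma xExp_le (l : ℕ) (d : ℕ × ℕ) :
    (xExp l d : ℝ) + (l + 3) ≤ (2 * l + 4) * ((deg d : ℝ) + 1) := by
  have : xExp l d + (l + 3) ≤ (2 * l + 4) * (deg d + 1) := by
    unfold xExp deg
    nlinarith [Nat.zero_le (l * d.1), Nat.zero_le d.1]
  exact_mod_cast this

/-- The constant comparing the coefficients of the derivatives with `wnormTwo`. -/
def derivConst (l : ℕ) : ℝ≥0 := (2 * l + 4) ^ 2

section bounds

variable (ρ : ℝ≥0) (l : ℕ) (h : DoubleSeries)

lemma wnorm_serY_le : wnorm ρ (serY h) ≤ derivConst l * wnormTwo ρ h := by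
  refine wnorm_mul_le fun d => ?_
  have hl : (0 : ℝ) ≤ l := l.cast_nonneg
  have hd : (0 : ℝ) ≤ deg d := (deg d).cast_nonneg
  rw [abs_of_nonneg (by positivity), derivConst]
  push_cast
  rw [← mul_pow]
  nlinarith [mul_nonneg hl hd]

lemma wnorm_serX_le : wnorm ρ (serX l h) ≤ derivConst l * wnormTwo ρ h := by
  refine wnorm_mul_le fun d => ?_
  have hl : (0 : ℝ) ≤ l := l.cast_nonneg
  have hd : (0 : ℝ) ≤ deg d := (deg d).cast_nonneg
  have hx := xExp_le l d
  rw [abs_of_nonneg (by positivity), derivConst]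
  push_cast
  rw [← mul_pow]
  nlinarith [mul_nonneg hl hd]

lemma wnorm_serXX_le : wnorm ρ (serXX l h) ≤ derivConst l * wnormTwo ρ h := by
  refine wnorm_mul_le fun d => ?_
  have hl : (0 : ℝ) ≤ l := l.cast_nonneg
  have hx := xExp_le l d
  have hx0 : (0 : ℝ) ≤ xExp l d := (xExp l d).cast_nonneg
  rw [abs_of_nonneg (by positivity), derivConst]
  push_cast
  rw [← mul_pow, sq]
  gcongr
  linarith

lemma wnorm_serXY_le : wnorm ρ (serXY l h) ≤ derivConst l * wnormTwo ρ h := by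
  refine wnorm_mul_le fun d => ?_
  have hl : (0 : ℝ) ≤ l := l.cast_nonneg
  have hd : (0 : ℝ) ≤ deg d := (deg d).cast_nonneg
  have hx := xExp_le l d
  rw [abs_of_nonneg (by positivity), derivConst]
  push_cast
  rw [← mul_pow, sq]
  gcongr
  nlinarith [mul_nonneg hl hd]

lemma wnorm_serYY_le : wnorm ρ (serYY h) ≤ derivConst l * wnormTwo ρ h := by
  refine wnorm_mul_le fun d => ?_
  have hl : (0 : ℝ) ≤ l := l.cast_nonneg
  have hd : (0 : ℝ) ≤ deg d := (deg d).cast_nonneg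
  rw [abs_of_nonneg (by positivity), derivConst]
  push_cast
  rw [← mul_pow, sq]
  gcongr <;> nlinarith [mul_nonneg hl hd]

lemma wnorm_conv_sub_conv_le {f₁ f₂ g₁ g₂ : DoubleSeries} {a b : ℝ≥0∞} (hf₁ : wnorm ρ f₁ ≤ a)
    (hf₂ : wnorm ρ f₂ ≤ b) (hg₁ : wnorm ρ g₁ ≤ a) (hg₂ : wnorm ρ g₂ ≤ b) :
    wnorm ρ (conv f₁ f₂ - conv g₁ g₂) ≤ 2 * (a * b) := by
  refine (wnorm_sub_le _ _ _).trans ?_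
  rw [two_mul]
  exact add_le_add ((wnorm_conv_le _ _ _).trans (mul_le_mul' hf₁ hf₂))
    ((wnorm_conv_le _ _ _).trans (mul_le_mul' hg₁ hg₂))

lemma wnorm_quadPart_le {a : ℝ≥0∞} (ha : derivConst l * wnormTwo ρ h ≤ a) :
    wnorm ρ (quadPart l h) ≤ 2 * (a * a) :=
  wnorm_conv_sub_conv_le ρ ((wnorm_serY_le ρ l h).trans ha) ((wnorm_serXX_le ρ l h).trans ha)
    ((wnorm_serX_le ρ l h).trans ha) ((wnorm_serXY_le ρ l h).trans ha)

lemma wnorm_cubicPart_le {a : ℝ≥0∞} (ha : derivConst l * wnormTwo ρ h ≤ a) :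
    wnorm ρ (cubicPart l h) ≤ 2 * (a * (2 * (a * a))) :=
  wnorm_conv_sub_conv_le ρ ((wnorm_serY_le ρ l h).trans ha) (wnorm_quadPart_le ρ l h ha)
    ((wnorm_serX_le ρ l h).trans ha)
    (wnorm_conv_sub_conv_le ρ ((wnorm_serY_le ρ l h).trans ha) ((wnorm_serXY_le ρ l h).trans ha)
      ((wnorm_serX_le ρ l h).trans ha) ((wnorm_serYY_le ρ l h).trans ha))

/-- The small factor `ρ` is the norm of the monomials `p` and `e`; the rest is `2 · 2a²` from `2p`
times the quadratic part and `4a³` from the cubic part. -/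
lemma wnorm_rhs_le {a : ℝ≥0∞} (ha : derivConst l * wnormTwo ρ h ≤ a) :
    wnorm ρ (rhs l h) ≤ ρ * (4 * (a * a) + 4 * (a * (a * a))) := by
  refine (wnorm_add_le _ _ _).trans ?_
  have h1 := (wnorm_conv_le ρ (Pi.single (1, 0) 2) (quadPart l h)).trans
    (mul_le_mul' (wnorm_single ρ (1, 0) 2).le (wnorm_quadPart_le ρ l h ha))
  have h2 := (wnorm_conv_le ρ (Pi.single (0, 1) 1) (cubicPart l h)).trans
    (mul_le_mul' (wnorm_single ρ (0, 1) 1).le (wnorm_cubicPart_le ρ l h ha))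
  refine (add_le_add h1 h2).trans_eq ?_
  have : ‖(2 : ℝ)‖ₑ = 2 := by simp [enorm_eq_nnnorm]
  simp only [deg, this, enorm_one, one_mul, add_zero, zero_add, pow_one]
  ring

/-- No derivative is lost: `(n + 1)² ≤ 2n(2n + 1)` for `n ≥ 1`. The summand `1` is the prescribed
constant term. -/
lemma wnormTwo_step_le : wnormTwo ρ (step l h) ≤ 1 + wnorm ρ (rhs l h) := by
  have h1 : (1 : ℝ≥0∞) = wnorm ρ (Pi.single 0 1) := by simp [wnorm_single, deg]
  rw [h1, wnormTwo]
  unfold wnorm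
  rw [← ENNReal.tsum_add]
  refine ENNReal.tsum_le_tsum fun d => ?_
  rw [← add_mul]
  gcongr
  by_cases hd : d = 0
  · subst hd
    simp [step, deg]
  · rw [Pi.single_eq_of_ne hd, enorm_zero, zero_add]
    have hdeg : 1 ≤ deg d := by
      by_contra hlt
      exact hd (by unfold deg at hlt; ext <;> simp <;> omega)
    have hdeg' : (1 : ℝ) ≤ deg d := by exact_mod_cast hdeg
    have hle : ‖((deg d : ℝ) + 1) ^ 2 * step l h d‖ ≤ ‖rhs l h d‖ := by
      rw [step, if_neg hd, norm_mul, norm_div, Real.norm_eq_abs, Real.norm_eq_abs (_ * _),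
        abs_of_nonneg (by positivity), abs_of_nonneg (by positivity), ← mul_div_assoc,
        div_le_iff₀ (by positivity), mul_comm]
      gcongr
      nlinarith
    exact enorm_le_iff_norm_le.2 hle

end bounds

lemma exists_radius (l : ℕ) : ∃ ρ : ℝ≥0, 0 < ρ ∧ ∀ h : DoubleSeries,
    wnormTwo ρ h ≤ 2 → wnormTwo ρ (step l h) ≤ 2 := by
  set a : ℝ≥0 := derivConst l * 2 with ha
  have hapos : 0 < a := by rw [ha, derivConst]; positivity
  -- With `a` the bound on all derivatives over the ball of radius `2`, this `ρ` makes the bound on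
  -- the right-hand side exactly `1`.
  refine ⟨(4 * (a * a) + 4 * (a * (a * a)))⁻¹, by positivity, fun h hh => ?_⟩
  refine (wnormTwo_step_le _ l h).trans ?_
  have h1 := wnorm_rhs_le (4 * (a * a) + 4 * (a * (a * a)))⁻¹ l h (a := a)
    (by rw [ha]; push_cast; gcongr)
  have h2 : (((4 * (a * a) + 4 * (a * (a * a)))⁻¹ : ℝ≥0) : ℝ≥0∞) *
      (4 * (a * a) + 4 * (a * (a * a))) = 1 := by
    have : (4 * (a * a) + 4 * (a * (a * a)))⁻¹ * (4 * (a * a) + 4 * (a * (a * a))) = 1 :=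
      inv_mul_cancel₀ (by positivity)
    exact_mod_cast congrArg (fun t : ℝ≥0 => (t : ℝ≥0∞)) this
  rw [h2] at h1
  calc 1 + wnorm _ (rhs l h) ≤ 1 + 1 := by gcongr
    _ = 2 := one_add_one_eq_two

lemma agree_iterate (l : ℕ) {n m : ℕ} (hnm : n ≤ m) :
    Agree n ((step l)^[n] 0) ((step l)^[m] 0) := by
  induction n generalizing m with
  | zero => exact fun d hd => absurd hd (Nat.not_lt_zero _)
  | succ n ih =>
    obtain ⟨m, rfl⟩ : ∃ k, m = k + 1 := ⟨m - 1, by omega⟩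
    rw [Function.iterate_succ_apply', Function.iterate_succ_apply']
    exact (ih (by omega)).step

lemma exists_solution (l : ℕ) : ∃ (h : DoubleSeries) (ρ : ℝ≥0), 0 < ρ ∧ h 0 = 1 ∧
    serYY h = rhs l h ∧ wnormTwo ρ h ≠ ⊤ := by
  obtain ⟨ρ, hρ, hstep⟩ := exists_radius l
  -- The coefficients of degree less than `n` are stationary from the `n`-th iterate on, so degree
  -- `deg d` is read off at `deg d + 1`.
  set h : DoubleSeries := fun d => (step l)^[deg d + 1] 0 d with hh
  have hagree : ∀ n, Agree n h ((step l)^[n] 0) := fun n d hd =>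
    agree_iterate l (n := deg d + 1) hd d (Nat.lt_succ_self _)
  have hfix : ∀ d, h d = step l h d := fun d => by
    rw [(hagree (deg d)).step d (Nat.lt_succ_self _), ← Function.iterate_succ_apply' (step l)]
  have hbound : ∀ n, wnormTwo ρ ((step l)^[n] 0) ≤ 2 := fun n => by
    induction n with
    | zero => simp [wnormTwo, wnorm]
    | succ n ih =>
      rw [Function.iterate_succ_apply']
      exact hstep _ ih
  refine ⟨h, ρ, hρ, by simp [hfix 0, step], ?_, ?_⟩
  · ext d
    by_cases hd : d = 0
    · subst hd
      simp [rhs_zero, serYY, deg]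
    · have hdeg : (0 : ℝ) < deg d := by
        have : 0 < deg d := by
          by_contra hlt
          exact hd (by unfold deg at hlt; ext <;> simp <;> omega)
        exact_mod_cast this
      rw [serYY, hfix d, step, if_neg hd]
      field_simp
  -- The bound passes to the limit because each finite partial sum coincides with that of a late
  -- enough iterate.
  · refine ne_top_of_le_ne_top ENNReal.ofNat_ne_top (b := 2) ?_
    rw [wnormTwo, wnorm, ENNReal.tsum_eq_iSup_sum]
    refine iSup_le fun s => ?_
    refine le_trans ?_ (hbound (s.sup deg + 1))
    refine le_trans (le_of_eq ?_) (ENNReal.sum_le_tsum s)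
    refine sum_congr rfl fun d hd => ?_
    rw [hagree (s.sup deg + 1) d (Nat.lt_succ_of_le (le_sup hd))]

end DoubleSeries

/-! ### Fundamental forms of a graph -/

namespace ZMC

lemma partialU_eq {E : Type*} [NormedAddCommGroup E] [NormedSpace ℝ E] {f : ℝ × ℝ → E}
    {w : ℝ × ℝ} {f' : E} (hf : DifferentiableAt ℝ f w)
    (h : HasDerivAt (fun t => f (t, w.2)) f' w.1) : partialU f w = f' :=
  HasDerivAt.unique
    (hf.hasFDerivAt.comp_hasDerivAt w.1 ((hasDerivAt_id w.1).prodMk (hasDerivAt_const w.1 w.2))) h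

lemma partialV_eq {E : Type*} [NormedAddCommGroup E] [NormedSpace ℝ E] {f : ℝ × ℝ → E}
    {w : ℝ × ℝ} {f' : E} (hf : DifferentiableAt ℝ f w)
    (h : HasDerivAt (fun t => f (w.1, t)) f' w.2) : partialV f w = f' :=
  HasDerivAt.unique
    (hf.hasFDerivAt.comp_hasDerivAt w.2 ((hasDerivAt_const w.2 w.1).prodMk (hasDerivAt_id w.2))) h

lemma partialU_congr {E : Type*} [NormedAddCommGroup E] [NormedSpace ℝ E] {f g : ℝ × ℝ → E}
    {U : Set (ℝ × ℝ)} (hU : IsOpen U) (h : Set.EqOn f g U) : Set.EqOn (partialU f) (partialU g) U :=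
  fun w hw => by
    unfold partialU
    rw [(h.eventuallyEq_of_mem (hU.mem_nhds hw)).fderiv_eq]

lemma partialV_congr {E : Type*} [NormedAddCommGroup E] [NormedSpace ℝ E] {f g : ℝ × ℝ → E}
    {U : Set (ℝ × ℝ)} (hU : IsOpen U) (h : Set.EqOn f g U) : Set.EqOn (partialV f) (partialV g) U :=
  fun w hw => by
    unfold partialV
    rw [(h.eventuallyEq_of_mem (hU.mem_nhds hw)).fderiv_eq]

lemma hasFDerivAt_graphMap {ψ : ℝ × ℝ → ℝ} {w : ℝ × ℝ} (hψ : DifferentiableAt ℝ ψ w) :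
    HasFDerivAt (graphMap ψ) (ContinuousLinearMap.pi ![ContinuousLinearMap.fst ℝ ℝ ℝ,
      ContinuousLinearMap.snd ℝ ℝ ℝ, fderiv ℝ ψ w]) w := by
  rw [hasFDerivAt_pi]
  intro i
  fin_cases i
  · exact hasFDerivAt_fst
  · exact hasFDerivAt_snd
  · exact hψ.hasFDerivAt

lemma hasFDerivAt_vertical {g : ℝ × ℝ → ℝ} {w : ℝ × ℝ} (hg : DifferentiableAt ℝ g w) (a b : ℝ) :
    HasFDerivAt (fun w => (![a, b, g w] : Fin 3 → ℝ))
      (ContinuousLinearMap.pi ![0, 0, fderiv ℝ g w]) w := by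
  rw [hasFDerivAt_pi]
  intro i
  fin_cases i
  · exact hasFDerivAt_const a w
  · exact hasFDerivAt_const b w
  · exact hg.hasFDerivAt

lemma partialU_graphMap {ψ : ℝ × ℝ → ℝ} {w : ℝ × ℝ} (hψ : DifferentiableAt ℝ ψ w) :
    partialU (graphMap ψ) w = ![1, 0, partialU ψ w] := by
  rw [partialU, (hasFDerivAt_graphMap hψ).fderiv]
  ext i
  fin_cases i <;> simp [partialU]

lemma partialV_graphMap {ψ : ℝ × ℝ → ℝ} {w : ℝ × ℝ} (hψ : DifferentiableAt ℝ ψ w) :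
    partialV (graphMap ψ) w = ![0, 1, partialV ψ w] := by
  rw [partialV, (hasFDerivAt_graphMap hψ).fderiv]
  ext i
  fin_cases i <;> simp [partialV]

lemma partialU_vertical {g : ℝ × ℝ → ℝ} {w : ℝ × ℝ} (hg : DifferentiableAt ℝ g w) (a b : ℝ) :
    partialU (fun w => (![a, b, g w] : Fin 3 → ℝ)) w = ![0, 0, partialU g w] := by
  rw [partialU, (hasFDerivAt_vertical hg a b).fderiv]
  ext i
  fin_cases i <;> simp [partialU]

lemma partialV_vertical {g : ℝ × ℝ → ℝ} {w : ℝ × ℝ} (hg : DifferentiableAt ℝ g w) (a b : ℝ) :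
    partialV (fun w => (![a, b, g w] : Fin 3 → ℝ)) w = ![0, 0, partialV g w] := by
  rw [partialV, (hasFDerivAt_vertical hg a b).fderiv]
  ext i
  fin_cases i <;> simp [partialV]

lemma B_graphMap {ψ : ℝ × ℝ → ℝ} {w : ℝ × ℝ} (hψ : DifferentiableAt ℝ ψ w) :
    B (graphMap ψ) w = 1 - partialU ψ w ^ 2 - partialV ψ w ^ 2 := by
  simp only [B, matP, partialU_graphMap hψ, partialV_graphMap hψ, lorentz, Matrix.det_fin_two_of]
  simp
  ring

lemma A_graphMap {ψ : ℝ × ℝ → ℝ} {U : Set (ℝ × ℝ)} (hU : IsOpen U)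
    (hψ : AnalyticOnNhd ℝ ψ U) {w : ℝ × ℝ} (hw : w ∈ U) :
    A (graphMap ψ) w = (1 - partialV ψ w ^ 2) * partialU (partialU ψ) w +
      partialU ψ w * partialV ψ w * (partialV (partialU ψ) w + partialU (partialV ψ) w) +
      (1 - partialU ψ w ^ 2) * partialV (partialV ψ) w := by
  have hd : ∀ w ∈ U, DifferentiableAt ℝ ψ w := fun w hw => (hψ w hw).differentiableAt
  have hUd : DifferentiableAt ℝ (partialU ψ) w :=
    ((hψ.fderiv w hw).differentiableAt).clm_apply (differentiableAt_const _)
  have hVd : DifferentiableAt ℝ (partialV ψ) w :=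
    ((hψ.fderiv w hw).differentiableAt).clm_apply (differentiableAt_const _)
  have hfU : Set.EqOn (partialU (graphMap ψ)) (fun w => ![1, 0, partialU ψ w]) U :=
    fun w hw => partialU_graphMap (hd w hw)
  have hfV : Set.EqOn (partialV (graphMap ψ)) (fun w => ![0, 1, partialV ψ w]) U :=
    fun w hw => partialV_graphMap (hd w hw)
  rw [A, matP, matQ, normal, partialU_congr hU hfU hw, partialV_congr hU hfU hw,
    partialU_congr hU hfV hw, partialV_congr hU hfV hw, partialU_vertical hUd,
    partialV_vertical hUd, partialU_vertical hVd, partialV_vertical hVd, hfU hw, hfV hw,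
    Matrix.adjugate_fin_two_of]
  simp [Matrix.trace_fin_two, lorentz, crossProduct,
    Matrix.mulVec_diagonal]
  ring

/-- The graph of an analytic solution of the zero mean curvature equation is a ZMC-embedding. -/
lemma isZMCEmbedding_graphMap {ψ : ℝ × ℝ → ℝ} {U : Set (ℝ × ℝ)} (hU : IsOpen U)
    (hψ : AnalyticOnNhd ℝ ψ U) (hA : ∀ w ∈ U, A (graphMap ψ) w = 0) :
    IsZMCEmbedding U (graphMap ψ) := by
  have hinj : ∀ w ∈ U, Function.Injective (fderiv ℝ (graphMap ψ) w) := by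
    intro w hw v v' h
    rw [(hasFDerivAt_graphMap (hψ w hw).differentiableAt).fderiv] at h
    have h0 := congrFun h 0
    have h1 := congrFun h 1
    simp at h0 h1
    exact Prod.ext h0 h1
  have hsmooth : ContDiffOn ℝ ∞ (graphMap ψ) U := by
    rw [contDiffOn_pi]
    intro i
    fin_cases i
    · exact contDiff_fst.contDiffOn
    · exact contDiff_snd.contDiffOn
    · exact hψ.contDiffOn hU.uniqueDiffOn
  refine ⟨⟨hsmooth, ⟨U, hU, subset_rfl, subset_closure, hinj⟩, hA⟩, hinj, ?_⟩
  have hcont : Continuous fun p : U => graphMap ψ p :=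
    continuousOn_iff_continuous_domRestrict.1 hsmooth.continuousOn
  -- Projection to the first two coordinates is a continuous left inverse of the graph map.
  refine Topology.IsEmbedding.of_comp hcont
    (g := fun q : Fin 3 → ℝ => (q 0, q 1)) (by fun_prop) ?_
  exact Topology.IsEmbedding.subtypeVal

end ZMC

/-! ### Partial derivatives of a monomial times `h(p, e)` -/

namespace DoubleSeries

open ZMC

/-- The arguments `p = c x ^ (l + 1) y ^ 2` and `e = c ^ 2 x ^ (2 l + 4) y ^ 2`. -/
def arg (l : ℕ) (c : ℝ) (w : ℝ × ℝ) : ℝ × ℝ :=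
  (c * w.1 ^ (l + 1) * w.2 ^ 2, c ^ 2 * w.1 ^ (2 * l + 4) * w.2 ^ 2)

/-- Summability of a double series together with its first derivatives. -/
structure SummableOne (ρ : ℝ≥0) (f : DoubleSeries) : Prop where
  self : wnorm ρ f ≠ ⊤
  euler₁ : wnorm ρ (euler₁ f) ≠ ⊤
  euler₂ : wnorm ρ (euler₂ f) ≠ ⊤

variable {ρ : ℝ≥0} {f : DoubleSeries} {l : ℕ} {c : ℝ} {w : ℝ × ℝ}

lemma analyticAt_arg (l : ℕ) (c : ℝ) (w : ℝ × ℝ) : AnalyticAt ℝ (arg l c) w := by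
  have h1 : AnalyticAt ℝ (fun w : ℝ × ℝ => w.1) w := analyticAt_fst
  have h2 : AnalyticAt ℝ (fun w : ℝ × ℝ => w.2) w := analyticAt_snd
  exact ((analyticAt_const.mul (h1.pow _)).mul (h2.pow _)).prod
    ((analyticAt_const.mul (h1.pow _)).mul (h2.pow _))

lemma analyticAt_eval_arg (hρ : 0 < ρ) (hf : wnorm ρ f ≠ ⊤)
    (hw : arg l c w ∈ Metric.ball 0 (ρ : ℝ)) : AnalyticAt ℝ (fun w => eval f (arg l c w)) w :=
  (analyticOnNhd_eval hρ hf _ hw).comp (analyticAt_arg l c w)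

lemma clm_apply_pair (T : ℝ × ℝ →L[ℝ] ℝ) (a b : ℝ) : T (a, b) = a * T (1, 0) + b * T (0, 1) := by
  have : ((a, b) : ℝ × ℝ) = a • (1, 0) + b • (0, 1) := by simp
  rw [this, map_add, map_smul, map_smul, smul_eq_mul, smul_eq_mul]

lemma eval_xExp_add (hf : SummableOne ρ f) {z : ℝ × ℝ} (hz : ‖z‖ ≤ ρ) (r : ℝ) :
    eval (fun d => (xExp l d + r) * f d) z =
      (l + 1) * eval (euler₁ f) z + (2 * l + 4) * eval (euler₂ f) z + r * eval f z := by
  refine HasSum.tsum_eq ?_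
  refine ((((hasSum_eval hf.euler₁ hz).mul_left ((l : ℝ) + 1)).add
    ((hasSum_eval hf.euler₂ hz).mul_left (2 * (l : ℝ) + 4))).add
      ((hasSum_eval hf.self hz).mul_left r)).congr_fun fun d => ?_
  simp only [euler₁, euler₂, xExp]
  push_cast
  ring

lemma eval_two_deg_add (hf : SummableOne ρ f) {z : ℝ × ℝ} (hz : ‖z‖ ≤ ρ) (r : ℝ) :
    eval (fun d => (2 * deg d + r) * f d) z =
      2 * eval (euler₁ f) z + 2 * eval (euler₂ f) z + r * eval f z := by
  refine HasSum.tsum_eq ?_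
  refine ((((hasSum_eval hf.euler₁ hz).mul_left 2).add
    ((hasSum_eval hf.euler₂ hz).mul_left 2)).add
      ((hasSum_eval hf.self hz).mul_left r)).congr_fun fun d => ?_
  simp only [euler₁, euler₂, deg]
  push_cast
  ring

lemma hasDerivAt_eval_arg_fst (hρ : 0 < ρ) (hf : wnorm ρ f ≠ ⊤)
    (hw : arg l c w ∈ Metric.ball 0 (ρ : ℝ)) :
    HasDerivAt (fun t => eval f (arg l c (t, w.2)))
      (fderiv ℝ (eval f) (arg l c w)
        (c * ((l + 1) * w.1 ^ l) * w.2 ^ 2, c ^ 2 * ((2 * l + 4) * w.1 ^ (2 * l + 3)) * w.2 ^ 2))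
      w.1 := by
  have h1 : HasDerivAt (fun t => arg l c (t, w.2))
      (c * ((l + 1) * w.1 ^ l) * w.2 ^ 2, c ^ 2 * ((2 * l + 4) * w.1 ^ (2 * l + 3)) * w.2 ^ 2)
      w.1 := by
    have ha := ((hasDerivAt_pow (l + 1) w.1).const_mul c).mul_const (w.2 ^ 2)
    have hb := ((hasDerivAt_pow (2 * l + 4) w.1).const_mul (c ^ 2)).mul_const (w.2 ^ 2)
    have := ha.prodMk hb
    simpa [arg] using this
  exact (analyticOnNhd_eval hρ hf _ hw).differentiableAt.hasFDerivAt.comp_hasDerivAt w.1 h1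

lemma hasDerivAt_eval_arg_snd (hρ : 0 < ρ) (hf : wnorm ρ f ≠ ⊤)
    (hw : arg l c w ∈ Metric.ball 0 (ρ : ℝ)) :
    HasDerivAt (fun t => eval f (arg l c (w.1, t)))
      (fderiv ℝ (eval f) (arg l c w)
        (c * w.1 ^ (l + 1) * (2 * w.2), c ^ 2 * w.1 ^ (2 * l + 4) * (2 * w.2)))
      w.2 := by
  have h1 : HasDerivAt (fun t => arg l c (w.1, t))
      (c * w.1 ^ (l + 1) * (2 * w.2), c ^ 2 * w.1 ^ (2 * l + 4) * (2 * w.2)) w.2 := by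
    have ha := (hasDerivAt_pow 2 w.2).const_mul (c * w.1 ^ (l + 1))
    have hb := (hasDerivAt_pow 2 w.2).const_mul (c ^ 2 * w.1 ^ (2 * l + 4))
    have := ha.prodMk hb
    simpa [arg] using this
  exact (analyticOnNhd_eval hρ hf _ hw).differentiableAt.hasFDerivAt.comp_hasDerivAt w.2 h1

/-- Each term is a monomial in `x` and `y`, and `x∂ₓ` multiplies `x^(m+1) y^j p^a e^b` by its
`x`-exponent `xExp l (a, b) + m + 1`. The derivative keeps the same shape, with one power of `x`
fewer in front. -/
lemma partialU_monomial_mul_eval (hρ : 0 < ρ) (hf : SummableOne ρ f)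
    (hw : arg l c w ∈ Metric.ball 0 (ρ : ℝ)) (m j : ℕ) :
    partialU (fun w => c * w.1 ^ (m + 1) * w.2 ^ j * eval f (arg l c w)) w =
      c * w.1 ^ m * w.2 ^ j * eval (fun d => (xExp l d + (m + 1)) * f d) (arg l c w) := by
  have hz : ‖arg l c w‖ ≤ ρ := by simpa using (Metric.mem_ball.1 hw).le
  have hS := (analyticAt_eval_arg hρ hf.self hw).differentiableAt
  refine (partialU_eq (by fun_prop) ((((hasDerivAt_pow (m + 1) w.1).const_mul c).mul_const
    (w.2 ^ j)).mul (hasDerivAt_eval_arg_fst hρ hf.self hw))).trans ?_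
  have h1 := fderiv_eval_fst hρ hf.self hf.euler₁ hw
  have h2 := fderiv_eval_snd hρ hf.self hf.euler₂ hw
  rw [eval_xExp_add hf hz, ← h1, ← h2, clm_apply_pair]
  simp only [arg, add_tsub_cancel_right]
  push_cast
  ring

lemma partialV_monomial_mul_eval (hρ : 0 < ρ) (hf : SummableOne ρ f)
    (hw : arg l c w ∈ Metric.ball 0 (ρ : ℝ)) (m : ℕ) :
    partialV (fun w => c * w.1 ^ m * w.2 * eval f (arg l c w)) w =
      c * w.1 ^ m * eval (fun d => (2 * deg d + 1) * f d) (arg l c w) := by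
  have hz : ‖arg l c w‖ ≤ ρ := by simpa using (Metric.mem_ball.1 hw).le
  have hS := (analyticAt_eval_arg hρ hf.self hw).differentiableAt
  refine (partialV_eq (by fun_prop) (((hasDerivAt_id w.2).const_mul (c * w.1 ^ m)).mul
    (hasDerivAt_eval_arg_snd hρ hf.self hw))).trans ?_
  have h1 := fderiv_eval_fst hρ hf.self hf.euler₁ hw
  have h2 := fderiv_eval_snd hρ hf.self hf.euler₂ hw
  rw [eval_two_deg_add hf hz, ← h1, ← h2, clm_apply_pair]
  simp only [arg, id]
  ring

/-- With no power of `y` left in front, only `y∂_y` keeps the shape of the series; the axis `y = 0`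
is treated separately, using that `p` and `e` are even in `y`. -/
lemma mul_partialV_pow_mul_eval (hρ : 0 < ρ) (hf : SummableOne ρ f)
    (hw : arg l c w ∈ Metric.ball 0 (ρ : ℝ)) (m : ℕ) :
    w.2 * partialV (fun w => c * w.1 ^ m * eval f (arg l c w)) w =
      c * w.1 ^ m * eval (fun d => (2 * deg d + 0) * f d) (arg l c w) := by
  have hz : ‖arg l c w‖ ≤ ρ := by simpa using (Metric.mem_ball.1 hw).le
  have hS := (analyticAt_eval_arg hρ hf.self hw).differentiableAt
  rw [partialV_eq (by fun_prop) ((hasDerivAt_eval_arg_snd hρ hf.self hw).const_mul (c * w.1 ^ m))]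
  have h1 := fderiv_eval_fst hρ hf.self hf.euler₁ hw
  have h2 := fderiv_eval_snd hρ hf.self hf.euler₂ hw
  rw [eval_two_deg_add hf hz, ← h1, ← h2, clm_apply_pair]
  simp only [arg]
  ring

lemma partialV_pow_mul_eval_of_eq_zero (hρ : 0 < ρ) (hf : wnorm ρ f ≠ ⊤)
    (hw : arg l c w ∈ Metric.ball 0 (ρ : ℝ)) (m : ℕ) (h0 : w.2 = 0) :
    partialV (fun w => c * w.1 ^ m * eval f (arg l c w)) w = 0 := by
  have hS := (analyticAt_eval_arg hρ hf hw).differentiableAt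
  rw [partialV_eq (by fun_prop) ((hasDerivAt_eval_arg_snd hρ hf hw).const_mul (c * w.1 ^ m)),
    clm_apply_pair]
  simp [h0]

end DoubleSeries

/-! ### The ansatz solves the zero mean curvature equation -/

namespace DoubleSeries

open ZMC

variable {ρ : ℝ≥0} {h : DoubleSeries}

lemma wnorm_mul_ne_top (hh : wnormTwo ρ h ≠ ⊤) {μ : ℕ × ℕ → ℝ} (M : ℝ≥0)
    (hμ : ∀ d, |μ d| ≤ M * ((deg d : ℝ) + 1) ^ 2) : wnorm ρ (fun d => μ d * h d) ≠ ⊤ :=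
  ne_top_of_le_ne_top (ENNReal.mul_ne_top ENNReal.coe_ne_top hh) (wnorm_mul_le hμ)

/-- A first-order operator uses one of the two controlled derivatives and leaves one. -/
lemma summableOne_mul (hh : wnormTwo ρ h ≠ ⊤) {μ : ℕ × ℕ → ℝ} (M : ℝ≥0)
    (hμ : ∀ d, |μ d| ≤ M * ((deg d : ℝ) + 1)) : SummableOne ρ (fun d => μ d * h d) := by
  have hM : (0 : ℝ) ≤ M := M.coe_nonneg
  have h1 : ∀ d, (d.1 : ℝ) ≤ deg d + 1 := fun d => by
    have : d.1 ≤ deg d + 1 := by unfold deg; omega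
    exact_mod_cast this
  have h2 : ∀ d, (d.2 : ℝ) ≤ deg d + 1 := fun d => by
    have : d.2 ≤ deg d + 1 := by unfold deg; omega
    exact_mod_cast this
  refine ⟨wnorm_mul_ne_top hh M fun d => (hμ d).trans ?_, ?_, ?_⟩
  · have hd : (0 : ℝ) ≤ deg d := (deg d).cast_nonneg
    gcongr
    nlinarith
  · have := wnorm_mul_ne_top hh (μ := fun d => d.1 * μ d) M fun d => by
      rw [abs_mul, abs_of_nonneg d.1.cast_nonneg, sq, ← mul_assoc, mul_comm]
      gcongr
      exacts [hμ d, h1 d]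
    simp only [mul_assoc] at this
    exact this
  · have := wnorm_mul_ne_top hh (μ := fun d => d.2 * μ d) M fun d => by
      rw [abs_mul, abs_of_nonneg d.2.cast_nonneg, sq, ← mul_assoc, mul_comm]
      gcongr
      exacts [hμ d, h2 d]
    simp only [mul_assoc] at this
    exact this

lemma summableOne_self (hh : wnormTwo ρ h ≠ ⊤) : SummableOne ρ h := by
  have := summableOne_mul hh (μ := fun _ => 1) 1 fun d => by simp
  simpa using this

lemma summableOne_serX (l : ℕ) (hh : wnormTwo ρ h ≠ ⊤) : SummableOne ρ (serX l h) := by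
  refine summableOne_mul hh (2 * l + 4) fun d => ?_
  rw [abs_of_nonneg (by positivity)]
  push_cast
  exact xExp_le l d

lemma summableOne_serY (hh : wnormTwo ρ h ≠ ⊤) : SummableOne ρ (serY h) := by
  refine summableOne_mul hh 2 fun d => ?_
  rw [abs_of_nonneg (by positivity)]
  push_cast
  linarith

lemma ne_top_of_le_derivConst {l : ℕ} (hh : wnormTwo ρ h ≠ ⊤) {f : DoubleSeries}
    (hf : wnorm ρ f ≤ derivConst l * wnormTwo ρ h) : wnorm ρ f ≠ ⊤ :=
  ne_top_of_le_ne_top (ENNReal.mul_ne_top ENNReal.coe_ne_top hh) hf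

lemma wnorm_conv_ne_top {f g : DoubleSeries} (hf : wnorm ρ f ≠ ⊤) (hg : wnorm ρ g ≠ ⊤) :
    wnorm ρ (conv f g) ≠ ⊤ :=
  ne_top_of_le_ne_top (ENNReal.mul_ne_top hf hg) (wnorm_conv_le _ _ _)

lemma wnorm_sub_ne_top {f g : DoubleSeries} (hf : wnorm ρ f ≠ ⊤) (hg : wnorm ρ g ≠ ⊤) :
    wnorm ρ (f - g) ≠ ⊤ :=
  ne_top_of_le_ne_top (ENNReal.add_ne_top.2 ⟨hf, hg⟩) (wnorm_sub_le _ _ _)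

lemma eval_rhs (l : ℕ) (hh : wnormTwo ρ h ≠ ⊤) {z : ℝ × ℝ} (hz : ‖z‖ ≤ ρ) :
    eval (rhs l h) z =
      2 * z.1 * (eval (serY h) z * eval (serXX l h) z - eval (serX l h) z * eval (serXY l h) z) +
      z.2 * (eval (serY h) z *
          (eval (serY h) z * eval (serXX l h) z - eval (serX l h) z * eval (serXY l h) z) -
        eval (serX l h) z *
          (eval (serY h) z * eval (serXY l h) z - eval (serX l h) z * eval (serYY h) z)) := by
  have hY := ne_top_of_le_derivConst hh (wnorm_serY_le ρ l h)
  have hX := ne_top_of_le_derivConst hh (wnorm_serX_le ρ l h)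
  have hXX := ne_top_of_le_derivConst hh (wnorm_serXX_le ρ l h)
  have hXY := ne_top_of_le_derivConst hh (wnorm_serXY_le ρ l h)
  have hYY := ne_top_of_le_derivConst hh (wnorm_serYY_le ρ l h)
  have hq : wnorm ρ (quadPart l h) ≠ ⊤ :=
    wnorm_sub_ne_top (wnorm_conv_ne_top hY hXX) (wnorm_conv_ne_top hX hXY)
  have hi : wnorm ρ (conv (serY h) (serXY l h) - conv (serX l h) (serYY h)) ≠ ⊤ :=
    wnorm_sub_ne_top (wnorm_conv_ne_top hY hXY) (wnorm_conv_ne_top hX hYY)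
  have hc : wnorm ρ (cubicPart l h) ≠ ⊤ :=
    wnorm_sub_ne_top (wnorm_conv_ne_top hY hq) (wnorm_conv_ne_top hX hi)
  have hs : ∀ (i : ℕ × ℕ) (r : ℝ), wnorm ρ (Pi.single i r) ≠ ⊤ := fun i r => by
    rw [wnorm_single]
    exact ENNReal.mul_ne_top enorm_ne_top (ENNReal.pow_ne_top ENNReal.coe_ne_top)
  have eq : eval (quadPart l h) z =
      eval (serY h) z * eval (serXX l h) z - eval (serX l h) z * eval (serXY l h) z := by
    rw [quadPart, eval_sub (wnorm_conv_ne_top hY hXX) (wnorm_conv_ne_top hX hXY) hz,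
      eval_conv hY hXX hz, eval_conv hX hXY hz]
  rw [rhs, eval_add (wnorm_conv_ne_top (hs _ _) hq) (wnorm_conv_ne_top (hs _ _) hc) hz,
    eval_conv (hs _ _) hq hz, eval_conv (hs _ _) hc hz, eval_single, eval_single, cubicPart,
    eval_sub (wnorm_conv_ne_top hY hq) (wnorm_conv_ne_top hX hi) hz, eval_conv hY hq hz,
    eval_conv hX hi hz, eval_sub (wnorm_conv_ne_top hY hXY) (wnorm_conv_ne_top hX hYY) hz,
    eval_conv hY hXY hz, eval_conv hX hYY hz, eq]
  simp

/-- The function `y + c x ^ (l + 3) y h(p, e)`. -/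
noncomputable def height (l : ℕ) (c : ℝ) (h : DoubleSeries) (w : ℝ × ℝ) : ℝ :=
  w.2 + c * w.1 ^ (l + 3) * w.2 * eval h (arg l c w)

/-- The set of points whose image under `arg` lies in the ball of radius `ρ`. -/
def argDomain (ρ : ℝ≥0) (l : ℕ) (c : ℝ) : Set (ℝ × ℝ) := arg l c ⁻¹' Metric.ball 0 (ρ : ℝ)

lemma isOpen_argDomain (ρ : ℝ≥0) (l : ℕ) (c : ℝ) : IsOpen (argDomain ρ l c) :=
  Metric.isOpen_ball.preimage
    (continuous_iff_continuousAt.2 fun _ => (analyticAt_arg l c _).continuousAt)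

lemma norm_arg_le {l : ℕ} {c : ℝ} {w : ℝ × ℝ}
    (hw : w ∈ argDomain ρ l c) : ‖arg l c w‖ ≤ ρ := by
  simpa using (Metric.mem_ball.1 hw).le

variable (l : ℕ) (c : ℝ)

lemma analyticOnNhd_height (hρ : 0 < ρ) (hh : wnormTwo ρ h ≠ ⊤) :
    AnalyticOnNhd ℝ (height l c h) (argDomain ρ l c) := fun _ hw =>
  analyticAt_snd.add (((analyticAt_const.mul (analyticAt_fst.pow _)).mul analyticAt_snd).mul
    (analyticAt_eval_arg hρ (summableOne_self hh).self hw))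

lemma partialU_height (hρ : 0 < ρ) (hh : wnormTwo ρ h ≠ ⊤) :
    Set.EqOn (partialU (height l c h))
      (fun w => c * w.1 ^ (l + 2) * w.2 * eval (serX l h) (arg l c w)) (argDomain ρ l c) := by
  intro w hw
  have h1 := partialU_monomial_mul_eval (c := c) hρ (summableOne_self hh) hw (l + 2) 1
  have hS := (analyticAt_eval_arg (c := c) hρ (summableOne_self hh).self hw).differentiableAt
  have h2 : partialU (height l c h) w =
      partialU (fun w => c * w.1 ^ (l + 2 + 1) * w.2 ^ 1 * eval h (arg l c w)) w := by
    simp only [partialU]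
    unfold height
    rw [fderiv_fun_add (by fun_prop) (by fun_prop), fderiv_snd]
    simp
  rw [h2, h1]
  simp only [pow_one]
  congr 2
  ext d
  simp only [serX]
  push_cast
  ring

lemma partialV_height (hρ : 0 < ρ) (hh : wnormTwo ρ h ≠ ⊤) :
    Set.EqOn (partialV (height l c h))
      (fun w => 1 + c * w.1 ^ (l + 3) * eval (serY h) (arg l c w)) (argDomain ρ l c) := by
  intro w hw
  have h1 := partialV_monomial_mul_eval (c := c) hρ (summableOne_self hh) hw (l + 3)
  have hS := (analyticAt_eval_arg (c := c) hρ (summableOne_self hh).self hw).differentiableAt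
  have h2 : partialV (height l c h) w =
      1 + partialV (fun w => c * w.1 ^ (l + 3) * w.2 * eval h (arg l c w)) w := by
    simp only [partialV]
    unfold height
    rw [fderiv_fun_add (by fun_prop) (by fun_prop), fderiv_snd]
    simp
  rw [h2, h1]
  rfl

lemma partialV_one_add (g : ℝ × ℝ → ℝ) : partialV (fun w => 1 + g w) = partialV g := by
  funext w
  simp only [partialV, fderiv_const_add]

lemma partialU_one_add (g : ℝ × ℝ → ℝ) : partialU (fun w => 1 + g w) = partialU g := by
  funext w
  simp only [partialU, fderiv_const_add]

lemma A_height (hρ : 0 < ρ) (hh : wnormTwo ρ h ≠ ⊤) (hsol : serYY h = rhs l h) {w : ℝ × ℝ}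
    (hw : w ∈ argDomain ρ l c) : A (graphMap (height l c h)) w = 0 := by
  have hU := isOpen_argDomain ρ l c
  have hz := norm_arg_le hw
  have eXX : partialU (partialU (height l c h)) w =
      c * w.1 ^ (l + 1) * w.2 * eval (serXX l h) (arg l c w) := by
    rw [partialU_congr hU (partialU_height l c hρ hh) hw]
    have h1 := partialU_monomial_mul_eval (c := c) hρ (summableOne_serX l hh) hw (l + 1) 1
    simp only [pow_one] at h1
    refine h1.trans ?_
    congr 2
    ext d
    simp only [serX, serXX]
    push_cast
    ring
  have eXY : partialV (partialU (height l c h)) w =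
      c * w.1 ^ (l + 2) * eval (serXY l h) (arg l c w) := by
    rw [partialV_congr hU (partialU_height l c hρ hh) hw]
    refine (partialV_monomial_mul_eval (c := c) hρ (summableOne_serX l hh) hw (l + 2)).trans ?_
    congr 2
    ext d
    simp only [serX, serXY]
    ring
  have eYX : partialU (partialV (height l c h)) w =
      c * w.1 ^ (l + 2) * eval (serXY l h) (arg l c w) := by
    rw [partialU_congr hU (partialV_height l c hρ hh) hw, partialU_one_add]
    have h1 := partialU_monomial_mul_eval (c := c) hρ (summableOne_serY hh) hw (l + 2) 0
    simp only [pow_zero, mul_one] at h1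
    refine h1.trans ?_
    congr 2
    ext d
    simp only [serY, serXY]
    push_cast
    ring
  have eV := partialV_congr hU (partialV_height l c hρ hh) hw
  rw [partialV_one_add] at eV
  rw [A_graphMap hU (analyticOnNhd_height l c hρ hh) hw, eXX, eXY, eYX, eV,
    partialU_height l c hρ hh hw, partialV_height l c hρ hh hw]
  -- The Fuchsian form is the equation times `y`. On `y = 0` the equation holds directly, since
  -- `ψ_x`, `ψ_xx` and `ψ_yy` all vanish there.
  rcases eq_or_ne w.2 0 with h0 | h0
  · rw [partialV_pow_mul_eval_of_eq_zero hρ (summableOne_serY hh).self hw _ h0]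
    simp [h0]
  · have eYY := mul_partialV_pow_mul_eval (c := c) hρ (summableOne_serY hh) hw (l + 3)
    have hser : (fun d => (2 * (deg d : ℝ) + 0) * serY h d) = serYY h := by
      ext d
      simp only [serY, serYY]
      ring
    have hrhs := eval_rhs l hh hz
    rw [← hsol] at hrhs
    rw [hser] at eYY
    generalize partialV (fun w => c * w.1 ^ (l + 3) * eval (serY h) (arg l c w)) w = V at *
    refine mul_left_cancel₀ h0 ?_
    beta_reduce
    generalize eval (serY h) (arg l c w) = Y at *
    generalize eval (serX l h) (arg l c w) = X at *
    generalize eval (serXX l h) (arg l c w) = XX at *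
    generalize eval (serXY l h) (arg l c w) = XY at *
    generalize eval (serYY h) (arg l c w) = YY at *
    simp only [arg] at hrhs
    linear_combination (1 - (c * w.1 ^ (l + 2) * w.2 * X) ^ 2) * eYY + c * w.1 ^ (l + 3) * hrhs

end DoubleSeries

/-! ### Sign of `B`, expansion in powers of `x`, and the domain -/

namespace DoubleSeries

open ZMC

variable {ρ : ℝ≥0} {h : DoubleSeries} (l : ℕ) (c : ℝ)

/-- The factor of `B` carrying its sign. -/
noncomputable def signFactor (h : DoubleSeries) (q : (ℝ × ℝ) × ℝ) : ℝ :=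
  2 * eval (serY h) q.1 + q.2 * eval (serY h) q.1 ^ 2 + q.1.1 * eval (serX l h) q.1 ^ 2

/-- `ψ_x² = e X²` and `ψ_y = 1 + s Y`; as `e = s p`, the factor `s` splits off from `1 - ψ_x² -
ψ_y²`. -/
lemma B_height (hρ : 0 < ρ) (hh : wnormTwo ρ h ≠ ⊤) {w : ℝ × ℝ} (hw : w ∈ argDomain ρ l c) :
    B (graphMap (height l c h)) w =
      -(c * w.1 ^ (l + 3) * signFactor l h (arg l c w, c * w.1 ^ (l + 3))) := by
  rw [B_graphMap (analyticOnNhd_height l c hρ hh w hw).differentiableAt,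
    partialU_height l c hρ hh hw, partialV_height l c hρ hh hw]
  simp only [signFactor, arg]
  ring

/-- The factor is continuous, and equals `2` at the origin because `h` has constant term `1`. -/
lemma exists_signFactor_pos (hρ : 0 < ρ) (hh : wnormTwo ρ h ≠ ⊤) (h0 : h 0 = 1) :
    ∃ δ > 0, ∀ z : ℝ × ℝ, ∀ s : ℝ, ‖z‖ < δ → |s| < δ → 0 < signFactor l h (z, s) := by
  have hball : (0 : ℝ × ℝ) ∈ Metric.ball 0 (ρ : ℝ) := Metric.mem_ball_self hρ
  have hY : ContinuousAt (fun q : (ℝ × ℝ) × ℝ => eval (serY h) q.1) ((0, 0), 0) :=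
    ContinuousAt.comp (g := eval (serY h)) (f := Prod.fst)
      (analyticOnNhd_eval hρ (summableOne_serY hh).self 0 hball).continuousAt continuousAt_fst
  have hX : ContinuousAt (fun q : (ℝ × ℝ) × ℝ => eval (serX l h) q.1) ((0, 0), 0) :=
    ContinuousAt.comp (g := eval (serX l h)) (f := Prod.fst)
      (analyticOnNhd_eval hρ (summableOne_serX l hh).self 0 hball).continuousAt continuousAt_fst
  have hc : ContinuousAt (signFactor l h) ((0, 0), 0) := by
    unfold signFactor
    fun_prop
  have hv : 0 < signFactor l h ((0, 0), 0) := by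
    have : eval (serY h) (0, 0) = 1 := (eval_zero _).trans (by simp [serY, deg, h0])
    simp [signFactor, this]
  obtain ⟨δ, hδ, hb⟩ := Metric.eventually_nhds_iff.1 (hc.eventually (lt_mem_nhds hv))
  refine ⟨δ, hδ, fun z s hz hs => hb ?_⟩
  rw [Prod.dist_eq, max_lt_iff]
  exact ⟨by rwa [Prod.mk_zero_zero, dist_zero_right], by simpa [Real.dist_eq] using hs⟩

/-- The bi-indices contributing to the coefficient of `x ^ k`. -/
def fiber (k : ℕ) : Finset (ℕ × ℕ) :=
  (range (k + 1) ×ˢ range (k + 1)).filter fun d => l + 3 + xExp l d = k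

lemma mem_fiber {k : ℕ} {d : ℕ × ℕ} : d ∈ fiber l k ↔ l + 3 + xExp l d = k := by
  rw [fiber, Finset.mem_filter, and_iff_right_iff_imp, Finset.mem_product, Finset.mem_range,
    Finset.mem_range, xExp]
  intro h
  constructor <;> nlinarith [Nat.zero_le (l * d.1), Nat.zero_le (l * d.2)]

/-- The coefficients `β k` of the expansion of `height` in powers of `x`. -/
def expansionCoeff (h : DoubleSeries) (k : ℕ) (y : ℝ) : ℝ :=
  k * ∑ d ∈ fiber l k, c ^ (1 + d.1 + 2 * d.2) * h d * y ^ (1 + 2 * deg d)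

lemma analyticOnNhd_expansionCoeff (k : ℕ) :
    AnalyticOnNhd ℝ (expansionCoeff l c h k) Set.univ := fun _ _ =>
  analyticAt_const.mul (Finset.analyticAt_fun_sum _ fun _ _ =>
    analyticAt_const.mul (analyticAt_id.pow _))

lemma hasSum_fiber {F : ℕ × ℕ → ℝ} {s : ℝ} (hF : HasSum F s) :
    HasSum (fun j : ℕ => ∑ d ∈ fiber l (j + 3), F d) s := by
  -- The term `p^a e^b` contributes to `x^k` with `k = l + 3 + xExp l (a, b)`, so the fibres are
  -- indexed by `j = k - 3`.
  have h1 := (Equiv.sigmaFiberEquiv fun d => l + xExp l d).hasSum_iff.2 hF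
  refine h1.sigma fun j => ?_
  have h2 : HasSum (fun d : {d // l + xExp l d = j} => F d) (∑ d ∈ fiber l (j + 3), F d) := by
    have hset : {d | l + xExp l d = j} = (fiber l (j + 3) : Set (ℕ × ℕ)) := by
      ext d
      rw [mem_coe, mem_fiber, Set.mem_ofPred_eq]
      omega
    have h3 := (fiber l (j + 3)).hasSum F
    have h4 : HasSum (fun d : ((fiber l (j + 3) : Set (ℕ × ℕ)) : Set (ℕ × ℕ)) => F d)
      (∑ d ∈ fiber l (j + 3), F d) := h3
    rw [← hset] at h4
    exact h4
  exact h2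

lemma hasSum_expansionCoeff (hh : wnormTwo ρ h ≠ ⊤) {x y : ℝ} (hw : (x, y) ∈ argDomain ρ l c) :
    HasSum (fun j : ℕ => expansionCoeff l c h (j + 3) y / ((j : ℝ) + 3) * x ^ (j + 3))
      (height l c h (x, y) - y) := by
  have h1 := (hasSum_eval (summableOne_self hh).self (norm_arg_le hw)).mul_left
    (c * x ^ (l + 3) * y)
  have h2 : height l c h (x, y) - y = c * x ^ (l + 3) * y * eval h (arg l c (x, y)) := by
    simp [height]
  rw [h2]
  refine (hasSum_fiber l h1).congr_fun fun j => ?_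
  have hj : ((j : ℝ) + 3) ≠ 0 := by positivity
  rw [expansionCoeff]
  push_cast
  rw [mul_div_right_comm, div_self hj, one_mul, sum_mul]
  refine sum_congr rfl fun d hd => ?_
  rw [← (mem_fiber l).1 hd]
  simp only [arg, xExp, deg, mul_pow, ← pow_mul]
  ring

lemma expansionCoeff_of_lt {k : ℕ} (hk : k < l + 3) (y : ℝ) : expansionCoeff l c h k y = 0 := by
  have : fiber l k = ∅ := by
    ext d
    simp only [mem_fiber, notMem_empty, iff_false]
    omega
  simp [expansionCoeff, this]

lemma expansionCoeff_self (h0 : h 0 = 1) (y : ℝ) :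
    expansionCoeff l c h (l + 3) y = (l + 3) * c * y := by
  have : fiber l (l + 3) = {0} := by
    ext d
    rw [mem_fiber, mem_singleton]
    constructor
    · intro hd
      have : xExp l d = 0 := by omega
      unfold xExp at this
      ext <;> simp <;> nlinarith [Nat.zero_le (l * d.1), Nat.zero_le (l * d.2)]
    · rintro rfl
      simp [xExp]
  simp only [expansionCoeff, this, sum_singleton, h0]
  simp [deg]
  ring

lemma deg_pos_of_mem_fiber {k : ℕ} (hk : l + 3 < k) {d : ℕ × ℕ} (hd : d ∈ fiber l k) :
    0 < deg d := by
  rw [mem_fiber] at hd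
  by_contra hlt
  have : d = 0 := by
    unfold deg at hlt
    ext <;> simp <;> omega
  subst this
  simp [xExp] at hd
  omega

lemma expansionCoeff_zero (k : ℕ) : expansionCoeff l c h k 0 = 0 := by
  unfold expansionCoeff
  rw [sum_eq_zero, mul_zero]
  intro d _
  rw [zero_pow (by omega), mul_zero]

/-- Beyond the leading coefficient every index has positive degree, so each term carries `y` to a
power at least `3`. -/
lemma deriv_expansionCoeff_zero {k : ℕ} (hk : l + 3 < k) :
    deriv (expansionCoeff l c h k) 0 = 0 := by
  have h1 : HasDerivAt (expansionCoeff l c h k)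
      (k * ∑ d ∈ fiber l k, c ^ (1 + d.1 + 2 * d.2) * h d *
        (((1 + 2 * deg d : ℕ) : ℝ) * 0 ^ (1 + 2 * deg d - 1))) 0 := by
    have := HasDerivAt.fun_sum (u := fiber l k)
      (A := fun d y => c ^ (1 + d.1 + 2 * d.2) * h d * y ^ (1 + 2 * deg d))
      (fun d _ => (hasDerivAt_pow (1 + 2 * deg d) (0 : ℝ)).const_mul
        (c ^ (1 + d.1 + 2 * d.2) * h d))
    exact this.const_mul (k : ℝ)
  rw [h1.deriv, sum_eq_zero, mul_zero]
  intro d hd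
  have := deg_pos_of_mem_fiber l hk hd
  rw [zero_pow (by omega), mul_zero, mul_zero]

/-- A neighbourhood of the `y`-axis that gets thinner at infinity. -/
def thin (ε : ℝ) : Set (ℝ × ℝ) := {w | |w.1| * (1 + w.2 ^ 2) < ε}

lemma isOpen_thin (ε : ℝ) : IsOpen (thin ε) :=
  isOpen_lt (by fun_prop) continuous_const

lemma zero_mem_thin {ε : ℝ} (hε : 0 < ε) (y : ℝ) : ((0 : ℝ), y) ∈ thin ε := by
  simpa [thin] using hε

lemma thin_mono {ε ε' : ℝ} (h : ε ≤ ε') : thin ε ⊆ thin ε' := fun _ hw => lt_of_lt_of_le hw h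

lemma isConnected_thin {ε : ℝ} (hε : 0 < ε) : IsConnected (thin ε) := by
  have hstar : StarConvex ℝ 0 (thin ε) := by
    rw [starConvex_zero_iff]
    intro w hw t ht0 ht1
    refine lt_of_le_of_lt ?_ (show |w.1| * (1 + w.2 ^ 2) < ε from hw)
    simp only [Prod.smul_fst, Prod.smul_snd, smul_eq_mul, abs_mul, abs_of_nonneg ht0, mul_pow]
    gcongr
    · exact mul_le_of_le_one_left (abs_nonneg _) ht1
    · exact mul_le_of_le_one_left (sq_nonneg _) (pow_le_one₀ ht0 ht1)
  exact (hstar.isPathConnected (zero_mem_thin hε 0)).isConnected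

lemma exists_thin_subset {δ : ℝ} (hδ : 0 < δ) :
    ∃ ε > 0, ∀ w ∈ thin ε, ‖arg l c w‖ < δ ∧ |c * w.1 ^ (l + 3)| < δ := by
  have hK : 0 < |c| + c ^ 2 + 1 := by positivity
  -- The bound `1` gives `|x| ≤ 1`, so each positive power of `|x|` is at most `|x|`; every quantity
  -- is then at most `(|c| + c²) |x| (1 + y²)`.
  refine ⟨min 1 (δ / (|c| + c ^ 2 + 1)), by positivity, fun w hw => ?_⟩
  obtain ⟨hw1, hw2⟩ := lt_min_iff.1 (show |w.1| * (1 + w.2 ^ 2) < min _ _ from hw)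
  rw [lt_div_iff₀ hK] at hw2
  have hx1 : |w.1| ≤ 1 := by nlinarith [abs_nonneg w.1, mul_nonneg (abs_nonneg w.1) (sq_nonneg w.2)]
  have hxm : ∀ m : ℕ, |w.1| ^ (m + 1) ≤ |w.1| := fun m =>
    pow_le_of_le_one (abs_nonneg _) hx1 (Nat.succ_ne_zero m)
  have hc0 := abs_nonneg c
  have hx0 := abs_nonneg w.1
  have hy := sq_nonneg w.2
  have key : ∀ a b m : ℝ, 0 ≤ a → a ≤ |c| + c ^ 2 → 0 ≤ m → m ≤ |w.1| → 0 ≤ b → b ≤ 1 + w.2 ^ 2 →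
      a * m * b < δ := by
    intro a b m ha ha' hm hm' hb hb'
    have : a * m * b ≤ (|c| + c ^ 2) * |w.1| * (1 + w.2 ^ 2) := by gcongr
    nlinarith [mul_nonneg hx0 hy]
  have hc2 := sq_nonneg c
  refine ⟨?_, ?_⟩
  · rw [Prod.norm_def, max_lt_iff]
    simp only [arg, Real.norm_eq_abs, abs_mul, abs_pow, sq_abs]
    exact ⟨key _ _ _ hc0 (by linarith) (by positivity) (hxm l) hy (by linarith),
      key _ _ _ hc2 (by linarith) (by positivity) (hxm (2 * l + 3)) hy (by linarith)⟩
  · rw [abs_mul, abs_pow, ← mul_one (|c| * _)]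
    exact key _ _ _ hc0 (by linarith) (by positivity) (hxm (l + 2)) zero_le_one (by linarith)

end DoubleSeries

/-! ### Assembly of the three graphs -/

namespace ZMC

open DoubleSeries

lemma containsEntireNullLine_graphMap {U : Set (ℝ × ℝ)} {ψ : ℝ × ℝ → ℝ}
    (hU : ∀ y : ℝ, ((0 : ℝ), y) ∈ U) (hψ : ∀ y, ψ (0, y) = y)
    (hB : ∀ y, B (graphMap ψ) (0, y) = 0) : ContainsEntireNullLine U (graphMap ψ) nullLine := by
  refine ⟨⟨0, ![0, 1, 1], ?_, ?_, ?_⟩, Set.univ, fun y => (0, y), isOpen_univ, Set.ordConnected_univ,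
    Set.univ_nonempty, ?_, fun y _ => hU y, ?_, ?_⟩
  · intro h
    simpa using congrFun h 1
  · simp [lorentz]
  · simp [nullLine]
  · exact (contDiff_const.prodMk contDiff_id).contDiffOn
  · intro y _
    simp [IsNullPoint, IsSpaceLikePoint, IsTimeLikePoint, hB]
  · simp [nullLine, graphMap, hψ]

/-- For every `c` and `l` there is a zero mean curvature graph along the entire null line whose
first nontrivial coefficient is `β (l + 3) = (l + 3) c y`. -/
theorem exists_graph_of_leading_coefficient (l : ℕ) (c : ℝ) :
    ∃ (ε₀ : ℝ) (ψ : ℝ × ℝ → ℝ) (β : ℕ → ℝ → ℝ), 0 < ε₀ ∧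
      (∀ ε, 0 < ε → ε ≤ ε₀ → IsZMCGraphOfTypeZeroI (thin ε) ψ β) ∧
      (∀ k y, k < l + 3 → β k y = 0) ∧ (∀ y, β (l + 3) y = (l + 3) * c * y) ∧
      (∀ k, l + 3 < k → β k 0 = 0 ∧ deriv (β k) 0 = 0) ∧
      ∀ w ∈ thin ε₀, ∃ θ > 0, B (graphMap ψ) w = -(c * w.1 ^ (l + 3) * θ) := by
  obtain ⟨h, ρ, hρ, h0, hsol, hh⟩ := exists_solution l
  obtain ⟨δ, hδ, hpos⟩ := exists_signFactor_pos l hρ hh h0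
  have hρ' : (0 : ℝ) < ρ := hρ
  -- The bound `ρ` secures convergence of the series, `δ` the sign of `B`.
  obtain ⟨ε₀, hε₀, hthin⟩ := exists_thin_subset l c (lt_min hδ hρ')
  have hsub : thin ε₀ ⊆ argDomain ρ l c := fun w hw => by
    simpa [argDomain] using (hthin w hw).1.trans_le (min_le_right _ _)
  refine ⟨ε₀, height l c h, expansionCoeff l c h, hε₀, fun ε hε hle => ?_,
    fun k y hk => expansionCoeff_of_lt l c hk y, expansionCoeff_self l c h0,
    fun k hk => ⟨expansionCoeff_zero l c k, deriv_expansionCoeff_zero l c hk⟩, fun w hw => ?_⟩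
  · have hsub' := (thin_mono hle).trans hsub
    have hψ := (analyticOnNhd_height l c hρ hh).mono hsub'
    refine ⟨hψ, isZMCEmbedding_graphMap (isOpen_thin ε) hψ fun w hw =>
        A_height l c hρ hh hsol (hsub' hw),
      containsEntireNullLine_graphMap (zero_mem_thin hε) (fun y => by simp [height]) fun y => ?_,
      fun _ _ => analyticAt_const, fun k _ => analyticOnNhd_expansionCoeff l c k,
      fun x y hxy => ?_⟩
    · rw [B_height l c hρ hh (hsub' (zero_mem_thin hε y))]
      simp
    · simpa [alphaZeroI] using hasSum_expansionCoeff l c hh (hsub' hxy)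
  · obtain ⟨h1, h2⟩ := hthin w hw
    exact ⟨_, hpos _ _ (h1.trans_le (min_le_left _ _)) (h2.trans_le (min_le_left _ _)),
      B_height l c hρ hh (hsub hw)⟩

end ZMC

open ZMC DoubleSeries in
theorem mainTheorem2 (c₁ c₂ c₃ : ℝ) (hc₁ : 0 < c₁) (hc₂ : c₂ < 0) (hc₃ : 0 < c₃) :
    ∃ (U : Set (ℝ × ℝ)) (ψ₁ ψ₂ ψ₃ : ℝ × ℝ → ℝ) (β₁ β₂ β₃ : ℕ → ℝ → ℝ),
      IsOpen U ∧ IsConnected U ∧ (∀ y : ℝ, ((0 : ℝ), y) ∈ U) ∧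
      -- the graph of mixed type
      (ZMC.IsZMCGraphOfTypeZeroI U ψ₁ β₁ ∧
        (∀ y, β₁ 3 y = 3 * c₁ * y) ∧
        (∀ k, 4 ≤ k → β₁ k 0 = 0 ∧ deriv (β₁ k) 0 = 0) ∧
        ZMC.IsMixedType U (ZMC.graphMap ψ₁)) ∧
      -- the graph that is space-like off the `y`-axis
      (ZMC.IsZMCGraphOfTypeZeroI U ψ₂ β₂ ∧
        (∀ y, β₂ 3 y = 0) ∧ (∀ y, β₂ 4 y = 4 * c₂ * y) ∧
        (∀ k, 5 ≤ k → β₂ k 0 = 0 ∧ deriv (β₂ k) 0 = 0) ∧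
        ∀ p ∈ U, (ZMC.IsSpaceLikePoint (ZMC.graphMap ψ₂) p ↔ p.1 ≠ 0)) ∧
      -- the graph that is time-like off the `y`-axis
      (ZMC.IsZMCGraphOfTypeZeroI U ψ₃ β₃ ∧
        (∀ y, β₃ 3 y = 0) ∧ (∀ y, β₃ 4 y = 4 * c₃ * y) ∧
        (∀ k, 5 ≤ k → β₃ k 0 = 0 ∧ deriv (β₃ k) 0 = 0) ∧
        ∀ p ∈ U, (ZMC.IsTimeLikePoint (ZMC.graphMap ψ₃) p ↔ p.1 ≠ 0)) := by
  -- The leading power is `x³` for `l = 0` and `x⁴` for `l = 1`; its parity decides whether `B`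
  -- changes sign across the axis.
  obtain ⟨ε₁, ψ₁, β₁, hε₁, hg₁, -, hβ₁, hk₁, hB₁⟩ := exists_graph_of_leading_coefficient 0 c₁
  obtain ⟨ε₂, ψ₂, β₂, hε₂, hg₂, hl₂, hβ₂, hk₂, hB₂⟩ := exists_graph_of_leading_coefficient 1 c₂
  obtain ⟨ε₃, ψ₃, β₃, hε₃, hg₃, hl₃, hβ₃, hk₃, hB₃⟩ := exists_graph_of_leading_coefficient 1 c₃
  set ε := min ε₁ (min ε₂ ε₃) with hεdef
  have hε : 0 < ε := lt_min hε₁ (lt_min hε₂ hε₃)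
  have h₁ : ε ≤ ε₁ := min_le_left _ _
  have h₂ : ε ≤ ε₂ := (min_le_right _ _).trans (min_le_left _ _)
  have h₃ : ε ≤ ε₃ := (min_le_right _ _).trans (min_le_right _ _)
  refine ⟨thin ε, ψ₁, ψ₂, ψ₃, β₁, β₂, β₃, isOpen_thin ε, isConnected_thin hε, zero_mem_thin hε,
    ⟨hg₁ ε hε h₁, fun y => by simpa using hβ₁ y, fun k hk => hk₁ k (by omega), ?_, ?_⟩,
    ⟨hg₂ ε hε h₂, fun y => hl₂ 3 y (by norm_num), fun y => ?_, fun k hk => hk₂ k (by omega), ?_⟩,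
    ⟨hg₃ ε hε h₃, fun y => hl₃ 3 y (by norm_num), fun y => ?_, fun k hk => hk₃ k (by omega), ?_⟩⟩
  -- Since `B = -c₁ x³ θ` with `c₁, θ > 0`, points with `x < 0` are space-like and points with `x >
  -- 0` time-like.
  · have hp : ((-(ε / 2), 0) : ℝ × ℝ) ∈ thin ε := by
      simp only [thin, Set.mem_ofPred_eq, abs_neg, abs_of_pos (half_pos hε)]
      linarith
    obtain ⟨θ, hθ, hB⟩ := hB₁ _ (thin_mono h₁ hp)
    refine ⟨_, hp, ?_⟩
    rw [IsSpaceLikePoint, hB]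
    have : 0 < c₁ * (ε / 2) ^ 3 * θ := by positivity
    nlinarith
  · have hp : ((ε / 2, 0) : ℝ × ℝ) ∈ thin ε := by
      simp only [thin, Set.mem_ofPred_eq, abs_of_pos (half_pos hε)]
      linarith
    obtain ⟨θ, hθ, hB⟩ := hB₁ _ (thin_mono h₁ hp)
    refine ⟨_, hp, ?_⟩
    rw [IsTimeLikePoint, hB]
    have : 0 < c₁ * (ε / 2) ^ 3 * θ := by positivity
    linarith
  · rw [show (4 : ℕ) = 1 + 3 from rfl, hβ₂]
    norm_num
  · intro p hp
    obtain ⟨θ, hθ, hB⟩ := hB₂ _ (thin_mono h₂ hp)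
    rw [IsSpaceLikePoint, hB]
    constructor
    · rintro h h0
      simp [h0] at h
    · intro h
      have : 0 < -c₂ * p.1 ^ 4 * θ := by
        have := neg_pos.2 hc₂
        positivity
      norm_num
      linarith
  · rw [show (4 : ℕ) = 1 + 3 from rfl, hβ₃]
    norm_num
  · intro p hp
    obtain ⟨θ, hθ, hB⟩ := hB₃ _ (thin_mono h₃ hp)
    rw [IsTimeLikePoint, hB]
    constructor
    · rintro h h0
      simp [h0] at h
    · intro h
      have : 0 < c₃ * p.1 ^ 4 * θ := by positivity
      norm_num
      linarith
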